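/- **Notation.** For $n\ge 1$ let $\mathcal A_n=\bigl(\prod_p \mathbb Z/p^n\mathbb Z\bigr)\big/\bigl(\bigoplus_p \mathbb Z/p^n\mathbb Z\bigr)$ ($p$ running over all primes), with the discrete topology, and let $\widehat{\mathcal A}=\varprojlim_n\mathcal A_n$ be Rosen's $\mathbb Q$-algebra with the inverse limit topology, $\pi\colon\prod_p\mathbb Z_p\to\widehat{\mathcal A}$ the natural map, and $\boldsymbol p=\pi((p)_p)$. For positive integers $k_1,\dots,k_r$ ($r\ge 0$) put $$\zeta_{\widehat{\mathcal A}}(k_1,\dots,k_r)=\pi\Bigl(\Bigl(\sum_{1\le n_1<\cdots<n_r\le p-1}\frac1{n_1^{k_1}\cdots n_r^{k_r}}\Bigr)_p\Bigr)\in\widehat{\mathcal A}.$$ Let $\mathfrak H=\mathbb Q\langle x,y\rangle$, $\mathfrak H^1=\mathbb Q+y\mathfrak H$, $z_k=yx^{k-1}$ for $k\ge1$, and let $Z_{\widehat{\mathcal A}}\colon\mathfrak H^1\to\widehat{\mathcal A}$ be the $\mathbb Q$-linear map with $Z_{\widehat{\mathcal A}}(1)=1$ and $Z_{\widehat{\mathcal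 A}}(z_{k_1}\cdots z_{k_r})=\zeta_{\widehat{\mathcal A}}(k_1,\dots,k_r)$. For $l\ge1$ let $\partial_l$ be the (Ihara–Kaneko–Zagier) $\mathbb Q$-linear derivation of $\mathfrak H$ with $\partial_l(x)=y(x+y)^{l-1}x$ and $\partial_l(y)=-y(x+y)^{l-1}x$, extended coefficientwise to $\mathfrak H[[u,v]]$, where $u,v$ are central variables. On $\mathfrak H[[u,v]]$ put $$\Delta_u=\exp\Bigl(\sum_{l=1}^\infty\frac{\partial_l}{l}(-u)^l\Bigr),$$ let $R_x(F)=Fx$ (an injective map, with inverse $R_x^{-1}$ on its image), and let $\beta_{m,n}\colon\mathfrak H[[u,v]]\to\mathfrak H$ take the coefficient of $u^mv^n$. **Theorem.** Let $m\ge0$ be an integer and $w\in y\mathfrak H$, and put $$F=w-w\,yu\,\frac1{1+xu}\cdot\frac{xv}{1-xv}\in\mathfrak H[[u,v]].$$ Then $\Delta_uR_x(F)$ lies in the image of $R_x$, the elements $\beta_{m,n}R_x^{-1}\Delta_uR_x(F)$ lie in $\mathfrak H^1$ for all $n\ge0$, and $$\sum_{n=0}^\infty Z_{\widehat{\mathcal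 A}}\bigl(\beta_{m,n}R_x^{-1}\Delta_uR_x(F)\bigr)\,\boldsymbol p^n = Z_{\widehat{\mathcal A}}(w)\;Z_{\widehat{\mathcal A}}\Bigl(\beta_{m,0}\Bigl(\frac1{1-yu}\Bigr)\Bigr)$$ in $\widehat{\mathcal A}$, the series converging in the topology of $\widehat{\mathcal A}$. -/

import Mathlib

/-! ### The ring `Â` -/

namespace FMZV

instance factPrime (p : Nat.Primes) : Fact (p : ℕ).Prime := ⟨p.2⟩

/-- The ideal `⨁_p ℤ/pⁿℤ` of `∏_p ℤ/pⁿℤ`: the families that vanish for all but finitely many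
primes `p`. -/
def finSupp (n : ℕ) : Ideal (∀ p : Nat.Primes, ZMod ((p : ℕ) ^ n)) where
  carrier := {a | {p | a p ≠ 0}.Finite}
  add_mem' {a b} ha hb := by
    refine (Set.Finite.union ha hb).subset fun p hp => ?_
    by_contra h
    simp only [Set.mem_union, Set.mem_ofPred_eq, not_or, not_not] at h
    exact hp (by simp [h.1, h.2])
  zero_mem' := by simp
  smul_mem' c a ha := by
    refine Set.Finite.subset ha fun p hp h => hp ?_
    simp [h]

/-- The ring `𝒜_n = (∏_p ℤ/pⁿℤ) / (⨁_p ℤ/pⁿℤ)`. (`𝒜_0` is the zero ring.) -/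
def A (n : ℕ) : Type := (∀ p : Nat.Primes, ZMod ((p : ℕ) ^ n)) ⧸ finSupp n

noncomputable instance (n : ℕ) : CommRing (A n) := Ideal.Quotient.commRing (finSupp n)

/-- `𝒜_n` carries the discrete topology. -/
instance (n : ℕ) : TopologicalSpace (A n) := ⊥

instance (n : ℕ) : DiscreteTopology (A n) := ⟨rfl⟩

/-- The class in `𝒜_n` of a family of residues modulo `pⁿ`. -/
noncomputable def A.mk (n : ℕ) : (∀ p : Nat.Primes, ZMod ((p : ℕ) ^ n)) →+* A n :=
  Ideal.Quotient.mk (finSupp n)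

/-- Componentwise reduction `∏_p ℤ/pⁿ⁺¹ℤ → ∏_p ℤ/pⁿℤ`. -/
def reduce (n : ℕ) :
    (∀ p : Nat.Primes, ZMod ((p : ℕ) ^ (n + 1))) →+* (∀ p : Nat.Primes, ZMod ((p : ℕ) ^ n)) :=
  RingHom.pi fun p =>
    (ZMod.castHom (pow_dvd_pow (p : ℕ) n.le_succ) (ZMod ((p : ℕ) ^ n))).comp
      (Pi.evalRingHom _ p)

/-- The natural projection `𝒜_{n+1} → 𝒜_n`. -/
noncomputable def A.proj (n : ℕ) : A (n + 1) →+* A n :=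
  Ideal.quotientMap (finSupp n) (reduce n) (by
    intro a ha
    refine Set.Finite.subset ha fun p hp h => hp ?_
    change (ZMod.castHom (pow_dvd_pow (p : ℕ) n.le_succ) (ZMod ((p : ℕ) ^ n))) (a p) = 0
    rw [h, map_zero])

/-- `Â` as the subring of compatible sequences in `∏_n 𝒜_n`. -/
def AhatSubring : Subring (∀ n, A n) where
  carrier := {a | ∀ n, A.proj n (a (n + 1)) = a n}
  mul_mem' ha hb n := by simp [ha n, hb n]
  one_mem' n := by simp
  add_mem' ha hb n := by simp [ha n, hb n]
  zero_mem' n := by simp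
  neg_mem' ha n := by simp [ha n]

/-- Rosen's ring `Â = lim_n 𝒜_n`. As a subtype of the product of the discrete rings `𝒜_n`, it
carries the inverse limit topology. -/
abbrev Ahat : Type := AhatSubring

/-- The natural projection `π : ∏_p ℤ_p → Â`. -/
noncomputable def toAhat : (∀ p : Nat.Primes, ℤ_[(p : ℕ)]) →+* Ahat :=
  (RingHom.pi fun n => (A.mk n).comp
    (RingHom.pi fun p => (PadicInt.toZModPow n).comp (Pi.evalRingHom _ p))).codRestrict
    AhatSubring (by
      intro a n
      change A.proj n (A.mk (n + 1) _) = A.mk n _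
      refine (Ideal.quotientMap_mk (I := finSupp n) (J := finSupp (n + 1)) (f := reduce n)).trans ?_
      congr 1
      funext p
      exact congrArg (fun f => f (a p)) (PadicInt.zmod_cast_comp_toZModPow n (n + 1) n.le_succ))

/-- The element `𝐩 = π((p)_p)` of `Â`. -/
noncomputable def bp : Ahat := toAhat fun p => ((p : ℕ) : ℤ_[(p : ℕ)])

lemma toAhat_eq_of_finite {a b : ∀ p : Nat.Primes, ℤ_[(p : ℕ)]} (h : {p | a p ≠ b p}.Finite) :
    toAhat a = toAhat b := by
  refine Subtype.ext (funext fun n => ?_)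
  change A.mk n _ = A.mk n _
  refine Ideal.Quotient.eq.mpr ?_
  refine h.subset fun p hp hab => hp ?_
  change PadicInt.toZModPow n (a p) - PadicInt.toZModPow n (b p) = 0
  rw [hab, sub_self]

lemma isUnit_intCast (k : ℤ) (hk : k ≠ 0) : IsUnit (k : Ahat) := by
  refine IsUnit.of_mul_eq_one (toAhat fun p => Ring.inverse (k : ℤ_[(p : ℕ)])) ?_
  rw [← map_intCast toAhat k, ← map_mul, ← map_one toAhat]
  refine toAhat_eq_of_finite ?_
  refine Set.Finite.subset
    (s := {p : Nat.Primes | (p : ℕ) ∈ k.natAbs.primeFactors})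
    (Set.Finite.preimage Subtype.val_injective.injOn (Finset.finite_toSet _)) fun p hp => ?_
  simp only [Set.mem_ofPred_eq, Nat.mem_primeFactors]
  refine ⟨p.2, ?_, by simpa using hk⟩
  by_contra hdvd
  refine hp ?_
  have hu : IsUnit (k : ℤ_[(p : ℕ)]) := by
    rw [PadicInt.isUnit_iff]
    refine le_antisymm (PadicInt.norm_le_one _) (not_lt.mp fun hlt => hdvd ?_)
    exact Int.natCast_dvd.mp ((PadicInt.norm_int_lt_one_iff_dvd k).mp hlt)
  simpa using Ring.mul_inverse_cancel _ hu

/-- The `ℚ`-algebra structure of `Â` (every nonzero integer is invertible in `Â`). -/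
noncomputable instance : Algebra ℚ Ahat :=
  (IsLocalization.lift (M := nonZeroDivisors ℤ) (S := ℚ) (g := Int.castRingHom Ahat)
    fun y => isUnit_intCast y (nonZeroDivisors.ne_zero y.2)).toAlgebra

/-! ### Finite multiple zeta values in `Â` -/

/-- The multiple harmonic sum `∑_{1 ≤ n_1 < ⋯ < n_r ≤ p-1} 1 / (n_1^{k_1} ⋯ n_r^{k_r})`, an element
of `ℤ_p`. The `n_i` are prime to `p`, so `Ring.inverse` is the honest inverse in `ℤ_p`. -/
noncomputable def harmonicSum (p : Nat.Primes) (k : List ℕ) : ℤ_[(p : ℕ)] :=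
  ∑ n ∈ (Fintype.piFinset fun _ : Fin k.length => Finset.Icc 1 ((p : ℕ) - 1)).filter
      (fun n => ∀ i j, i < j → n i < n j),
    ∏ i, Ring.inverse ((n i : ℤ_[(p : ℕ)]) ^ k.get i)

/-- The finite multiple zeta value `ζ_Â(k_1, …, k_r)`. -/
noncomputable def zetaAhat (k : List ℕ) : Ahat := toAhat fun p => harmonicSum p k

/-! ### The algebra `𝔥 = ℚ⟨x, y⟩` -/

/-- The two letters. -/
inductive Letter
  | x
  | y

/-- `𝔥 = ℚ⟨x, y⟩`. -/
abbrev H : Type := FreeAlgebra ℚ Letter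

/-- The generator `x` of `𝔥`. -/
noncomputable def x : H := FreeAlgebra.ι ℚ Letter.x

/-- The generator `y` of `𝔥`. -/
noncomputable def y : H := FreeAlgebra.ι ℚ Letter.y

/-- `z_k = y x^{k-1}` for `k ≥ 1`. -/
noncomputable def z (k : ℕ) : H := y * x ^ (k - 1)

/-- `y𝔥`. -/
noncomputable def yH : Submodule ℚ H := LinearMap.range (LinearMap.mulLeft ℚ y)

/-- `𝔥¹ = ℚ + y𝔥`. -/
noncomputable def H1 : Submodule ℚ H := 1 ⊔ yH

/-- A word is written uniquely as `x^c z_{k_1} ⋯ z_{k_r}`; this returns `(c, [k_1, …, k_r])`. -/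
def parse : List Letter → ℕ × List ℕ
  | [] => (0, [])
  | Letter.x :: w => ((parse w).1 + 1, (parse w).2)
  | Letter.y :: w => (0, ((parse w).1 + 1) :: (parse w).2)

/-- The `ℚ`-linear map `Z_Â` with `Z_Â(z_{k_1} ⋯ z_{k_r}) = ζ_Â(k_1, …, k_r)`. Its domain is `𝔥¹`,
which is spanned by these words; outside `𝔥¹` the value has no meaning
(words that start with `x` are sent to `0`). -/
noncomputable def Z : H →ₗ[ℚ] Ahat :=
  (FreeAlgebra.basisFreeMonoid ℚ Letter).constr ℚ fun w =>
    if (parse (FreeMonoid.toList w)).1 = 0 then zetaAhat (parse (FreeMonoid.toList w)).2 else 0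

lemma basis_apply (w : List Letter) :
    FreeAlgebra.basisFreeMonoid ℚ Letter (FreeMonoid.ofList w) =
      (w.map (FreeAlgebra.ι ℚ)).prod := by
  simp [FreeAlgebra.basisFreeMonoid, FreeAlgebra.equivMonoidAlgebraFreeMonoid,
    MonoidAlgebra.lift_single, FreeMonoid.lift_apply]

lemma parse_x_pow (c : ℕ) (w : List Letter) :
    parse (List.replicate c Letter.x ++ w) = ((parse w).1 + c, (parse w).2) := by
  induction c with
  | zero => simp
  | succ c ih => simp [List.replicate_succ, parse, ih, add_assoc]

lemma Z_word (k : List ℕ) (hk : ∀ i ∈ k, 1 ≤ i) : Z ((k.map z).prod) = zetaAhat k := by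
  have key : ∀ k : List ℕ, (∀ i ∈ k, 1 ≤ i) → ∃ w : List Letter, parse w = (0, k) ∧
      (w.map (FreeAlgebra.ι ℚ)).prod = (k.map z).prod := by
    intro k
    induction k with
    | nil => exact fun _ => ⟨[], rfl, by simp⟩
    | cons a k ih =>
      intro h
      obtain ⟨w, hw, hp⟩ := ih fun i hi => h i (List.mem_cons_of_mem _ hi)
      have ha : 1 ≤ a := h a List.mem_cons_self
      refine ⟨Letter.y :: (List.replicate (a - 1) Letter.x ++ w), ?_, ?_⟩
      · simp [parse, parse_x_pow, hw, Nat.sub_add_cancel ha]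
      · simp [z, hp, x, y, mul_assoc]
  obtain ⟨w, hw, hp⟩ := key k hk
  rw [← hp, ← basis_apply, Z, Module.Basis.constr_basis]
  simp [hw]

/-! ### The derivations `∂_l` -/

/-- The algebra map `a ↦ a + ε ∂_l(a)` from `𝔥` to the dual numbers over `𝔥`. -/
noncomputable def derivHom (l : ℕ) : H →ₐ[ℚ] DualNumber H :=
  FreeAlgebra.lift ℚ fun
    | Letter.x => TrivSqZeroExt.inl x + TrivSqZeroExt.inr (y * (x + y) ^ (l - 1) * x)
    | Letter.y => TrivSqZeroExt.inl y + TrivSqZeroExt.inr (-(y * (x + y) ^ (l - 1) * x))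

/-- The derivation `∂_l` (`l ≥ 1`) of `𝔥` with `∂_l(x) = y(x+y)^{l-1}x` and
`∂_l(y) = -y(x+y)^{l-1}x`; see `deriv_x`, `deriv_y`, `deriv_mul`. -/
noncomputable def deriv (l : ℕ) : H →ₗ[ℚ] H :=
  (TrivSqZeroExt.sndHom H H).restrictScalars ℚ ∘ₗ (derivHom l).toLinearMap

lemma deriv_x (l : ℕ) : deriv l x = y * (x + y) ^ (l - 1) * x := by
  simp [deriv, derivHom, x]

lemma deriv_y (l : ℕ) : deriv l y = -(y * (x + y) ^ (l - 1) * x) := by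
  simp [deriv, derivHom, y]

lemma deriv_mul (l : ℕ) (a b : H) : deriv l (a * b) = deriv l a * b + a * deriv l b := by
  have hfst : ∀ c : H, (derivHom l c).fst = c := by
    intro c
    have : (TrivSqZeroExt.fstHom ℚ H H).comp (derivHom l) = AlgHom.id ℚ H := by
      apply FreeAlgebra.hom_ext
      funext i
      cases i <;> simp [derivHom, x, y]
    exact DFunLike.congr_fun this c
  simp [deriv, hfst, add_comm]

/-! ### Power series in `u`, `v` and the operator `Δ_u` -/

/-- `𝔥[[u, v]]`, with central variables `u` (index `0`) and `v` (index `1`). -/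
abbrev S : Type := MvPowerSeries (Fin 2) H

/-- The variable `u`. -/
noncomputable def u : S := MvPowerSeries.X 0

/-- The variable `v`. -/
noncomputable def v : S := MvPowerSeries.X 1

/-- The inclusion `𝔥 → 𝔥[[u, v]]`. -/
noncomputable def C : H →+* S := MvPowerSeries.C

/-- `β_{m,n}`: the coefficient of `u^m v^n`. -/
noncomputable def β (m n : ℕ) : S →ₗ[H] H :=
  MvPowerSeries.coeff (Finsupp.single 0 m + Finsupp.single 1 n)

/-- The inverse `1/F` of a power series `F` with constant term `1`. -/
noncomputable def inv (F : S) : S := MvPowerSeries.invOfUnit F 1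

/-- The operator `∑_{l ≥ 1} (∂_l / l) (-u)^l` on `𝔥[[u, v]]`. The coefficient of its value at the
exponent `e` only involves the `l` with `1 ≤ l ≤ e 0`, where `e 0` is the exponent of `u`. -/
noncomputable def logDelta : S →ₗ[ℚ] S where
  toFun F := fun e => ∑ l ∈ Finset.Icc 1 (e 0),
    ((-1 : ℚ) ^ l / l) • deriv l (MvPowerSeries.coeff (e - Finsupp.single 0 l) F)
  map_add' F G := by
    funext e
    simp only [map_add, smul_add, Finset.sum_add_distrib]
    rfl
  map_smul' c F := by
    have h : ∀ e, MvPowerSeries.coeff e (c • F) = c • MvPowerSeries.coeff e F := fun e => rfl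
    funext e
    simp only [h, map_smul, RingHom.id_apply]
    refine Eq.trans ?_ (Finset.smul_sum (r := c)).symm
    exact Finset.sum_congr rfl fun l _ => smul_comm _ _ _

/-- Each application of `logDelta` raises the order in `u` by at least one, so only the `k ≤ e 0`
contribute to the coefficient at `e` of the exponential series. -/
lemma coeff_logDelta_pow (F : S) (k : ℕ) (e : Fin 2 →₀ ℕ) (h : e 0 < k) :
    MvPowerSeries.coeff e ((logDelta ^ k) F) = 0 := by
  induction k generalizing e with
  | zero => omega
  | succ k ih =>
    rw [pow_succ', Module.End.mul_apply]
    change ∑ l ∈ Finset.Icc 1 (e 0), _ = (0 : H)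
    refine Finset.sum_eq_zero fun l hl => ?_
    rw [Finset.mem_Icc] at hl
    rw [ih _ (by simp; omega), map_zero, smul_zero]

/-- `Δ_u = exp(∑_{l ≥ 1} (∂_l / l) (-u)^l) = ∑_{k ≥ 0} logDelta^k / k!` on `𝔥[[u, v]]`; the terms with
`k > e 0` of the exponential series do not contribute to the coefficient at `e`
(`coeff_logDelta_pow`). -/
noncomputable def Delta (F : S) : S := fun e =>
  ∑ k ∈ Finset.range (e 0 + 1),
    ((k.factorial : ℚ)⁻¹) • MvPowerSeries.coeff e ((logDelta ^ k) F)

/-- `R_x(F) = F x`. -/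
noncomputable def Rx (F : S) : S := F * C x

lemma Rx_injective : Function.Injective Rx := by
  intro F G h
  ext e
  have he := congrArg (MvPowerSeries.coeff e) h
  simp only [Rx, C, MvPowerSeries.coeff_mul_C] at he
  have hx : x ≠ 0 := FreeAlgebra.ι_ne_zero _
  exact mul_right_cancel₀ hx he

/-- The inverse `R_x^{-1}` of the injective map `R_x`, meaningful on the range of `R_x`. -/
noncomputable def RxInv : S → S := Function.invFun Rx

end FMZV

namespace FMZV

/-! ### Exponentials of operators that raise the order in `u` -/

/-! Fix a prime `p` and put `c j = 1/j`. With `S` the shift on vectors indexed by `0, …, p-1`, send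
`x` and `y` to `X = (1+S)⁻¹ diag(c)` and `Y = (1+S)⁻¹ S diag(c)`. Applied to the vector `λ` of
binomial coefficients of `p-1`, a word gives the binomial transform of its nested sum, and for a
word starting with `y` the entry `0` is the multiple harmonic sum (`wordZ_mulVec`,
`wordZ_y_mulVec_zero`).

`Δ_u` is the exponential of a derivation, hence a ring homomorphism. It fixes `x + y` and sends `x`
to `(1+yu)⁻¹x` (`one_add_mul_Delta_x`), so `R_x⁻¹ Δ_u R_x` is `F ↦ Δ_u(F)(1+yu)⁻¹`. In matrices,
`Δ_u` is conjugation by the diagonal matrix `D` with entries `g_k = ∏_{j ≤ k} (1+u/j)`: if `A =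
(1+uY)⁻¹`, then `D(AX) = XD`, and `D` commutes with `X + Y = diag(c)`. As `g_0 = 1`, entry `0` does
not see `D`. If `W` is the matrix of `w` and `ν = DAλ`, the value to compute is therefore entry `0`
of `W(1 - uY(1+uX)⁻¹ vX(1-vX)⁻¹)ν`.

At `v = p` this collapses: `exists_key_identity` gives an explicit `σ` with `(1+uX)(1-pX)σ = upXν`
and `Yσ = ν - g_{p-1}λ`, so the correction leaves exactly `g_{p-1}λ`. The coefficients of `g_{p-1} =
∏_{j<p} (1+u/j)` are the harmonic sums of the powers of `y`. For formal `v` the equality holds up to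
a multiple of `p - v` (`exists_twist`). Replacing `v^n` by `p^n` for `n < N` turns such a multiple
into a multiple of `p^N`, which gives the equality in every `𝒜_N` (`dvd_sum_twisted`,
`hasSum_Ahat`).

The images of the letters under `Δ_u` have integral coefficients, so the argument runs over `ℤ⟨x,
y⟩` and `ℤ_p`; rational coefficients enter at the end by linearity. -/

lemma coeff_ratSMul (e : Fin 2 →₀ ℕ) (c : ℚ) (F : S) :
    MvPowerSeries.coeff e (c • F) = c • MvPowerSeries.coeff e F := rfl

/-- All coefficients of `F` at exponents of `u` below `k` vanish. -/
def UOrderGE (k : ℕ) (F : S) : Prop := ∀ e : Fin 2 →₀ ℕ, e 0 < k → MvPowerSeries.coeff e F = 0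

/-- The operator `A` raises the order in `u`. -/
def RaisesU (A : S →ₗ[ℚ] S) : Prop := ∀ k F, UOrderGE k F → UOrderGE (k + 1) (A F)

lemma uOrderGE_zero (F : S) : UOrderGE 0 F := fun _ h => absurd h (Nat.not_lt_zero _)

lemma UOrderGE.mul {i j : ℕ} {F G : S} (hF : UOrderGE i F) (hG : UOrderGE j G) :
    UOrderGE (i + j) (F * G) := by
  intro e he
  rw [MvPowerSeries.coeff_mul]
  refine Finset.sum_eq_zero fun ab hab => ?_
  rw [Finset.HasAntidiagonal.mem_antidiagonal] at hab
  have h0 : ab.1 0 + ab.2 0 = e 0 := by rw [← hab]; rfl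
  rcases lt_or_ge (ab.1 0) i with h | h
  · rw [hF _ h, zero_mul]
  · rw [hG _ (by omega), mul_zero]

lemma UOrderGE.add {k : ℕ} {F G : S} (hF : UOrderGE k F) (hG : UOrderGE k G) :
    UOrderGE k (F + G) := fun e he => by rw [map_add, hF e he, hG e he, add_zero]

lemma RaisesU.pow {A : S →ₗ[ℚ] S} (hA : RaisesU A) (k : ℕ) (F : S) : UOrderGE k ((A ^ k) F) := by
  induction k with
  | zero => exact uOrderGE_zero _
  | succ k ih =>
    rw [pow_succ', Module.End.mul_apply]
    exact hA k _ ih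

lemma RaisesU.add {A B : S →ₗ[ℚ] S} (hA : RaisesU A) (hB : RaisesU B) : RaisesU (A + B) :=
  fun k F h => (hA k F h).add (hB k F h)

lemma raisesU_mulLeft {W : S} (hW : UOrderGE 1 W) : RaisesU (LinearMap.mulLeft ℚ W) := by
  intro k F h
  rw [add_comm]
  exact hW.mul h

/-- The exponential of an operator that raises the order in `u`. -/
noncomputable def expU (A : S →ₗ[ℚ] S) (F : S) : S := fun e =>
  ∑ k ∈ Finset.range (e 0 + 1),
    ((k.factorial : ℚ)⁻¹) • MvPowerSeries.coeff e ((A ^ k) F)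

/-- The range may be any bound above `e 0`, so that all exponents of an antidiagonal can share one
range. -/
lemma coeff_expU {A : S →ₗ[ℚ] S} (hA : RaisesU A) (F : S) (e : Fin 2 →₀ ℕ) {M : ℕ}
    (hM : e 0 ≤ M) :
    MvPowerSeries.coeff e (expU A F) =
      ∑ k ∈ Finset.range (M + 1), ((k.factorial : ℚ)⁻¹) • MvPowerSeries.coeff e ((A ^ k) F) := by
  refine Finset.sum_subset (Finset.range_mono (by omega)) fun k _ hk => ?_
  rw [Finset.mem_range] at hk
  rw [hA.pow k F e (by omega), smul_zero]

/-- The Leibniz rule is allowed three different operators because `one_add_mul_Delta_x`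
exponentiates an operator that is not a derivation. -/
lemma pow_apply_mul {A A' A'' : S →ₗ[ℚ] S} (h : ∀ F G, A (F * G) = A' F * G + F * A'' G)
    (F G : S) (n : ℕ) :
    (A ^ n) (F * G) = ∑ ij ∈ Finset.HasAntidiagonal.antidiagonal n,
      n.choose ij.1 • ((A' ^ ij.1) F * (A'' ^ ij.2) G) := by
  induction n with
  | zero => simp
  | succ n ih =>
    rw [Finset.sum_antidiagonal_choose_succ_nsmul (fun i j => (A' ^ i) F * (A'' ^ j) G), pow_succ',
      Module.End.mul_apply, ih, map_sum, ← Finset.sum_add_distrib]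
    refine Finset.sum_congr rfl fun ij hij => ?_
    have hc : n.choose ij.2 = n.choose ij.1 := by
      rw [Finset.HasAntidiagonal.mem_antidiagonal] at hij
      exact Nat.choose_symm_of_eq_add (by omega)
    rw [hc, map_nsmul, h, pow_succ', pow_succ', Module.End.mul_apply, Module.End.mul_apply,
      smul_add, add_comm]

lemma expU_mul {A A' A'' : S →ₗ[ℚ] S} (hA : RaisesU A) (hA' : RaisesU A') (hA'' : RaisesU A'')
    (h : ∀ F G, A (F * G) = A' F * G + F * A'' G) (F G : S) :
    expU A (F * G) = expU A' F * expU A'' G := by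
  ext e
  set T : ℕ × ℕ → H := fun ij => ((ij.1.factorial : ℚ)⁻¹ * (ij.2.factorial : ℚ)⁻¹) •
    MvPowerSeries.coeff e ((A' ^ ij.1) F * (A'' ^ ij.2) G) with hT
  have hl : MvPowerSeries.coeff e (expU A (F * G)) =
      ∑ n ∈ Finset.range (e 0 + 1), ∑ ij ∈ Finset.HasAntidiagonal.antidiagonal n, T ij := by
    rw [coeff_expU hA _ e le_rfl]
    refine Finset.sum_congr rfl fun n _ => ?_
    rw [pow_apply_mul h, map_sum, Finset.smul_sum]
    refine Finset.sum_congr rfl fun ij hij => ?_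
    rw [Finset.HasAntidiagonal.mem_antidiagonal] at hij
    rw [hT, ← Nat.cast_smul_eq_nsmul ℚ, coeff_ratSMul, smul_smul]
    congr 1
    rw [← hij, Nat.choose_symm_add, Nat.add_choose, Nat.cast_div (Nat.factorial_mul_factorial_dvd_factorial_add _ _)
      (by positivity)]
    push_cast
    field_simp
  have hr : MvPowerSeries.coeff e (expU A' F * expU A'' G) =
      ∑ ij ∈ Finset.range (e 0 + 1) ×ˢ Finset.range (e 0 + 1), T ij := by
    rw [MvPowerSeries.coeff_mul, hT]
    simp only [MvPowerSeries.coeff_mul, Finset.smul_sum]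
    rw [Finset.sum_comm]
    refine Finset.sum_congr rfl fun ab hab => ?_
    rw [Finset.HasAntidiagonal.mem_antidiagonal] at hab
    have h0 : ab.1 0 + ab.2 0 = e 0 := by rw [← hab]; rfl
    rw [coeff_expU hA' F ab.1 (M := e 0) (by omega), coeff_expU hA'' G ab.2 (M := e 0) (by omega),
      Finset.sum_mul_sum, Finset.sum_product]
    refine Finset.sum_congr rfl fun i _ => Finset.sum_congr rfl fun j _ => ?_
    rw [smul_mul_smul_comm]
  -- The triangle `i + j ≤ e 0` is compared with a square; the terms of the square outside the
  -- triangle have order in `u` above `e 0` and vanish.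
  rw [hl, hr, Finset.sum_sigma']
  refine Finset.sum_bij_ne_zero (fun p _ _ => p.2) ?_ ?_ ?_ ?_
  · rintro ⟨n, i, j⟩ h1 _
    simp only [Finset.mem_sigma, Finset.mem_range, Finset.HasAntidiagonal.mem_antidiagonal, Finset.mem_product]
      at h1 ⊢
    omega
  · rintro ⟨n, i, j⟩ h1 _ ⟨n', i', j'⟩ h2 _ heq
    simp only [Finset.mem_sigma, Finset.HasAntidiagonal.mem_antidiagonal] at h1 h2
    obtain ⟨rfl, rfl⟩ := Prod.mk.inj heq
    obtain rfl : n = n' := by omega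
    rfl
  · rintro ⟨i, j⟩ _ hne
    refine ⟨⟨i + j, i, j⟩, ?_, hne, rfl⟩
    simp only [Finset.mem_sigma, Finset.mem_range, Finset.HasAntidiagonal.mem_antidiagonal, and_true]
    by_contra hlt
    refine hne ?_
    rw [hT]
    simp only
    rw [(hA'.pow i F).mul (hA''.pow j G) e (by omega), smul_zero]
  · intros; rfl

lemma expU_of_apply_eq_zero {A : S →ₗ[ℚ] S} (hA : RaisesU A) {F : S} (h : A F = 0) :
    expU A F = F := by
  ext e
  rw [coeff_expU hA F e le_rfl, Finset.sum_range_succ', Finset.sum_eq_zero]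
  · simp
  · intro k _
    rw [pow_succ, Module.End.mul_apply, h, map_zero, map_zero, smul_zero]

/-! ### `Δ_u` is multiplicative -/

lemma deriv_one (l : ℕ) : deriv l 1 = 0 := by
  have := deriv_mul l 1 1
  simpa using this

lemma deriv_z_pow (l k : ℕ) : deriv l ((x + y) ^ k) = 0 := by
  induction k with
  | zero => simpa using deriv_one l
  | succ k ih => rw [pow_succ, deriv_mul, ih, map_add, deriv_x, deriv_y]; simp

lemma coeff_logDelta (F : S) (e : Fin 2 →₀ ℕ) :
    MvPowerSeries.coeff e (logDelta F) = ∑ l ∈ Finset.Icc 1 (e 0),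
      ((-1 : ℚ) ^ l / l) • deriv l (MvPowerSeries.coeff (e - Finsupp.single 0 l) F) := rfl

lemma raisesU_logDelta : RaisesU logDelta := by
  intro k F hF e he
  rw [coeff_logDelta]
  refine Finset.sum_eq_zero fun l hl => ?_
  rw [Finset.mem_Icc] at hl
  rw [hF _ (by simp; omega), map_zero, smul_zero]

/-- A range independent of `e` lets the sum over `l` be exchanged with a sum over an antidiagonal.
-/
lemma coeff_logDelta_of_le (F : S) (e : Fin 2 →₀ ℕ) {M : ℕ} (hM : e 0 ≤ M) :
    MvPowerSeries.coeff e (logDelta F) = ∑ l ∈ Finset.Icc 1 M, if Finsupp.single 0 l ≤ e then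
      ((-1 : ℚ) ^ l / l) • deriv l (MvPowerSeries.coeff (e - Finsupp.single 0 l) F) else 0 := by
  rw [coeff_logDelta, ← Finset.sum_filter]
  refine Finset.sum_congr ?_ fun _ _ => rfl
  ext l
  simp only [Finset.mem_Icc, Finset.mem_filter, Finsupp.single_le_iff]
  omega

/-- For each `l` the shift of exponents is multiplication by the central element `u^l`, so the rule
reduces to `deriv_mul` in each coefficient. -/
lemma logDelta_mul (F G : S) : logDelta (F * G) = logDelta F * G + F * logDelta G := by
  ext e
  have key : ∀ l : ℕ, (if Finsupp.single 0 l ≤ e then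
      ((-1 : ℚ) ^ l / l) • deriv l (MvPowerSeries.coeff (e - Finsupp.single 0 l) (F * G)) else 0) =
      ∑ ab ∈ Finset.HasAntidiagonal.antidiagonal e,
        ((if Finsupp.single 0 l ≤ ab.1 then ((-1 : ℚ) ^ l / l) •
          deriv l (MvPowerSeries.coeff (ab.1 - Finsupp.single 0 l) F) else 0) *
            MvPowerSeries.coeff ab.2 G +
        MvPowerSeries.coeff ab.1 F * (if Finsupp.single 0 l ≤ ab.2 then ((-1 : ℚ) ^ l / l) •
          deriv l (MvPowerSeries.coeff (ab.2 - Finsupp.single 0 l) G) else 0)) := by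
    intro l
    set s : Fin 2 →₀ ℕ := Finsupp.single 0 l with hs
    set q : ℚ := (-1 : ℚ) ^ l / l
    let dF : S := fun d => q • deriv l (MvPowerSeries.coeff d F)
    let dG : S := fun d => q • deriv l (MvPowerSeries.coeff d G)
    have hF : ∀ d, (if s ≤ d then q • deriv l (MvPowerSeries.coeff (d - s) F) else 0) =
        MvPowerSeries.coeff d (MvPowerSeries.monomial s 1 * dF) := by
      intro d
      rw [MvPowerSeries.coeff_monomial_mul, one_mul]
      rfl
    have hG : ∀ d, (if s ≤ d then q • deriv l (MvPowerSeries.coeff (d - s) G) else 0) =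
        MvPowerSeries.coeff d (MvPowerSeries.monomial s 1 * dG) := by
      intro d
      rw [MvPowerSeries.coeff_monomial_mul, one_mul]
      rfl
    have hc : F * (MvPowerSeries.monomial s 1 * dG) = MvPowerSeries.monomial s 1 * (F * dG) := by
      rw [← mul_assoc, ← mul_assoc, hs, ← MvPowerSeries.X_pow_eq, MvPowerSeries.X_pow_mul]
    simp only [hF, hG]
    rw [Finset.sum_add_distrib, ← MvPowerSeries.coeff_mul, ← MvPowerSeries.coeff_mul, hc,
      mul_assoc, ← map_add, ← mul_add, MvPowerSeries.coeff_monomial_mul, one_mul]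
    refine if_congr Iff.rfl ?_ rfl
    rw [map_add, MvPowerSeries.coeff_mul, MvPowerSeries.coeff_mul, MvPowerSeries.coeff_mul,
      map_sum, Finset.smul_sum, ← Finset.sum_add_distrib]
    refine Finset.sum_congr rfl fun ab _ => ?_
    rw [deriv_mul, smul_add, ← smul_mul_assoc, ← mul_smul_comm]
    rfl
  rw [coeff_logDelta_of_le _ e le_rfl, map_add, MvPowerSeries.coeff_mul, MvPowerSeries.coeff_mul,
    ← Finset.sum_add_distrib]
  simp only [key]
  rw [Finset.sum_comm]
  refine Finset.sum_congr rfl fun ab hab => ?_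
  rw [Finset.HasAntidiagonal.mem_antidiagonal] at hab
  have h0 : ab.1 0 + ab.2 0 = e 0 := by rw [← hab]; rfl
  rw [coeff_logDelta_of_le F ab.1 (M := e 0) (by omega),
    coeff_logDelta_of_le G ab.2 (M := e 0) (by omega), Finset.sum_mul, Finset.mul_sum,
    ← Finset.sum_add_distrib]

lemma Delta_mul (F G : S) : Delta (F * G) = Delta F * Delta G :=
  expU_mul raisesU_logDelta raisesU_logDelta raisesU_logDelta logDelta_mul F G

lemma logDelta_eq_zero {F : S} (h : ∀ l e, deriv l (MvPowerSeries.coeff e F) = 0) :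
    logDelta F = 0 := by
  ext e
  rw [coeff_logDelta]
  exact Finset.sum_eq_zero fun l _ => by rw [h, smul_zero]

lemma Delta_eq_self {F : S} (h : ∀ l e, deriv l (MvPowerSeries.coeff e F) = 0) : Delta F = F :=
  expU_of_apply_eq_zero raisesU_logDelta (logDelta_eq_zero h)

lemma Delta_one : Delta 1 = 1 := Delta_eq_self fun l e => by
  classical
  rw [MvPowerSeries.coeff_one]
  split_ifs <;> simp [deriv_one]

lemma Delta_X (i : Fin 2) : Delta (MvPowerSeries.X i) = MvPowerSeries.X i :=
  Delta_eq_self fun l e => by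
    classical
    rw [MvPowerSeries.coeff_X]
    split_ifs <;> simp [deriv_one]

/-- `Δ_u` as a ring homomorphism. -/
noncomputable def DeltaHom : S →+* S where
  toFun := Delta
  map_one' := Delta_one
  map_mul' := Delta_mul
  map_zero' := Delta_eq_self fun l e => by simp
  map_add' F G := by
    ext e
    have h : ∀ K : S, MvPowerSeries.coeff e (Delta K) = ∑ k ∈ Finset.range (e 0 + 1),
      ((k.factorial : ℚ)⁻¹) • MvPowerSeries.coeff e ((logDelta ^ k) K) := fun _ => rfl
    simp only [h, map_add, smul_add, Finset.sum_add_distrib]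

lemma DeltaHom_apply (F : S) : DeltaHom F = Delta F := rfl

/-! ### The value of `Δ_u` at `x` -/

/-- The series `∑_{l ≥ 1} (x+y)^{l-1} (-u)^l / l`. -/
noncomputable def logSeries : S := fun e =>
  if e 1 = 0 ∧ 1 ≤ e 0 then ((-1 : ℚ) ^ e 0 / e 0) • (x + y) ^ (e 0 - 1) else 0

lemma coeff_logSeries (e : Fin 2 →₀ ℕ) : MvPowerSeries.coeff e logSeries =
    if e 1 = 0 ∧ 1 ≤ e 0 then ((-1 : ℚ) ^ e 0 / e 0) • (x + y) ^ (e 0 - 1) else 0 := rfl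

lemma coeff_C_mul' (a : H) (F : S) (e : Fin 2 →₀ ℕ) :
    MvPowerSeries.coeff e (C a * F) = a * MvPowerSeries.coeff e F :=
  MvPowerSeries.coeff_C_mul e F a

lemma coeff_mul_C' (a : H) (F : S) (e : Fin 2 →₀ ℕ) :
    MvPowerSeries.coeff e (F * C a) = MvPowerSeries.coeff e F * a :=
  MvPowerSeries.coeff_mul_C e F a

lemma uOrderGE_logSeries : UOrderGE 1 logSeries := by
  intro e he
  rw [coeff_logSeries, if_neg (by omega)]

lemma coeff_logDelta_C (a : H) (e : Fin 2 →₀ ℕ) : MvPowerSeries.coeff e (logDelta (C a)) =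
    if e 1 = 0 ∧ 1 ≤ e 0 then ((-1 : ℚ) ^ e 0 / e 0) • deriv (e 0) a else 0 := by
  classical
  rw [coeff_logDelta]
  have hC : ∀ l, MvPowerSeries.coeff (e - Finsupp.single 0 l) (C a) =
      if e - Finsupp.single 0 l = 0 then a else 0 := fun l => MvPowerSeries.coeff_C _ _
  have h0 : ∀ l ∈ Finset.Icc 1 (e 0), (e - Finsupp.single 0 l = 0 ↔ e 1 = 0 ∧ l = e 0) := by
    intro l hl
    rw [Finset.mem_Icc] at hl
    constructor
    · intro h
      have h1 := DFunLike.congr_fun h 0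
      have h2 := DFunLike.congr_fun h 1
      simp at h1 h2
      omega
    · rintro ⟨h1, rfl⟩
      ext i
      fin_cases i <;> simp [h1]
  simp only [hC]
  split_ifs with h
  · rw [Finset.sum_eq_single_of_mem (e 0) (Finset.mem_Icc.2 ⟨h.2, le_rfl⟩)]
    · rw [if_pos ((h0 _ (Finset.mem_Icc.2 ⟨h.2, le_rfl⟩)).2 ⟨h.1, rfl⟩)]
    · intro l hl hne
      rw [if_neg fun h' => hne ((h0 l hl).1 h').2, map_zero, smul_zero]
  · refine Finset.sum_eq_zero fun l hl => ?_
    rw [if_neg, map_zero, smul_zero]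
    intro h'
    have h1 := (h0 l hl).1 h'
    rw [Finset.mem_Icc] at hl
    omega

lemma logDelta_x : logDelta (C x) = C y * logSeries * C x := by
  ext e
  rw [coeff_logDelta_C, coeff_mul_C', coeff_C_mul', coeff_logSeries]
  split_ifs
  · rw [deriv_x]; simp
  · simp

lemma logDelta_y : logDelta (C y) = -(C y * logSeries * C x) := by
  ext e
  rw [coeff_logDelta_C, map_neg, coeff_mul_C', coeff_C_mul', coeff_logSeries]
  split_ifs
  · rw [deriv_y]; simp
  · simp

lemma logDelta_logSeries : logDelta logSeries = 0 :=
  logDelta_eq_zero fun l e => by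
    rw [coeff_logSeries]
    split_ifs
    · rw [map_smul, deriv_z_pow, smul_zero]
    · exact map_zero _

/-- The series `log (1 + (x+y) u)`. -/
noncomputable def logOneAdd : S := -(C (x + y) * logSeries)

lemma coeff_logOneAdd (e : Fin 2 →₀ ℕ) : MvPowerSeries.coeff e logOneAdd =
    if e 1 = 0 ∧ 1 ≤ e 0 then -(((-1 : ℚ) ^ e 0 / e 0) • (x + y) ^ e 0) else 0 := by
  rw [logOneAdd, map_neg, coeff_C_mul', coeff_logSeries]
  split_ifs with h
  · rw [mul_smul_comm, ← pow_succ', Nat.sub_add_cancel h.2]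
  · simp

lemma uOrderGE_logOneAdd : UOrderGE 1 logOneAdd := by
  intro e he
  rw [coeff_logOneAdd, if_neg (by omega)]

lemma logDelta_logOneAdd : logDelta logOneAdd = 0 := by
  rw [logOneAdd, map_neg, logDelta_mul, logDelta_logSeries, map_add C, map_add, logDelta_x,
    logDelta_y]
  simp

lemma coeff_u (e : Fin 2 →₀ ℕ) :
    MvPowerSeries.coeff e u = if e 1 = 0 ∧ e 0 = 1 then 1 else 0 := by
  classical
  rw [u, MvPowerSeries.coeff_X]
  refine if_congr ?_ rfl rfl
  constructor
  · rintro rfl; simp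
  · rintro ⟨h1, h0⟩
    ext i
    fin_cases i <;> simp [h1, h0]

lemma coeff_u_mul (F : S) (e : Fin 2 →₀ ℕ) : MvPowerSeries.coeff e (u * F) =
    if 1 ≤ e 0 then MvPowerSeries.coeff (e - Finsupp.single 0 1) F else 0 := by
  rw [u, MvPowerSeries.X_def, MvPowerSeries.coeff_monomial_mul, one_mul]
  exact if_congr (by rw [Finsupp.single_le_iff]) rfl rfl

/-- The Euler derivation `u ∂/∂u`. -/
noncomputable def eulerU (F : S) : S := fun e => e 0 • MvPowerSeries.coeff e F

lemma coeff_eulerU (F : S) (e : Fin 2 →₀ ℕ) :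
    MvPowerSeries.coeff e (eulerU F) = e 0 • MvPowerSeries.coeff e F := rfl

lemma eulerU_mul (F G : S) : eulerU (F * G) = eulerU F * G + F * eulerU G := by
  ext e
  rw [coeff_eulerU, map_add, MvPowerSeries.coeff_mul, MvPowerSeries.coeff_mul,
    MvPowerSeries.coeff_mul, Finset.smul_sum, ← Finset.sum_add_distrib]
  refine Finset.sum_congr rfl fun ab hab => ?_
  rw [Finset.HasAntidiagonal.mem_antidiagonal] at hab
  have h0 : e 0 = ab.1 0 + ab.2 0 := by rw [← hab]; rfl
  rw [coeff_eulerU, coeff_eulerU, h0, add_smul, smul_mul_assoc, mul_smul_comm]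

/-- All coefficients are rational multiples of powers of `x + y`. -/
lemma commute_logOneAdd_eulerU : Commute logOneAdd (eulerU logOneAdd) := by
  have hz : ∀ e d, Commute (MvPowerSeries.coeff e logOneAdd)
      (MvPowerSeries.coeff d (eulerU logOneAdd)) := by
    intro e d
    rw [coeff_eulerU, coeff_logOneAdd, coeff_logOneAdd]
    refine Commute.smul_right ?_ _
    split_ifs
    · exact Commute.neg_left (Commute.neg_right
        (((Commute.pow_pow_self _ _ _).smul_left _).smul_right _))
    all_goals simp
  ext e
  rw [MvPowerSeries.coeff_mul, MvPowerSeries.coeff_mul]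
  refine Finset.sum_equiv (Equiv.prodComm _ _) (fun ab => ?_) fun ab _ => hz _ _
  simp [Finset.HasAntidiagonal.mem_antidiagonal, add_comm]

lemma eulerU_pow_logOneAdd (k : ℕ) : eulerU (logOneAdd ^ (k + 1)) =
    (k + 1) • (eulerU logOneAdd * logOneAdd ^ k) := by
  induction k with
  | zero => simp
  | succ k ih =>
    rw [pow_succ', eulerU_mul, ih, mul_smul_comm, ← mul_assoc, commute_logOneAdd_eulerU.eq,
      mul_assoc, ← pow_succ', succ_nsmul' _ (k + 1)]

/-- This is the logarithmic derivative `zu/(1+zu)` of `1 + zu`, where `z = x + y`, cleared of its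
denominator. -/
lemma one_add_mul_eulerU_logOneAdd :
    (1 + C (x + y) * u) * eulerU logOneAdd = C (x + y) * u := by
  ext e
  rw [add_mul, one_mul, map_add, mul_assoc, coeff_C_mul', coeff_u_mul, coeff_eulerU,
    coeff_eulerU, coeff_logOneAdd, coeff_logOneAdd, coeff_C_mul', coeff_u]
  have e1 : (e - Finsupp.single 0 1 : Fin 2 →₀ ℕ) 1 = e 1 := by simp
  have e0 : (e - Finsupp.single 0 1 : Fin 2 →₀ ℕ) 0 = e 0 - 1 := by simp
  rw [e1, e0]
  rcases eq_or_ne (e 1) 0 with h1 | h1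
  · rcases h : e 0 with _ | _ | n
    · simp
    · simp [h1, add_comm]
    · have hn : ((n : ℚ) + 1 + 1) ≠ 0 := by positivity
      have hn' : ((n : ℚ) + 1) ≠ 0 := by positivity
      simp only [h1, true_and, Nat.add_sub_cancel, le_add_iff_nonneg_left, zero_le, if_true,
        add_eq_right, Nat.add_eq_zero_iff, one_ne_zero, and_false, if_false, mul_zero, smul_neg,
        mul_neg, ← Nat.cast_smul_eq_nsmul ℚ, smul_smul, mul_smul_comm, ← pow_succ']
      push_cast
      rw [mul_div_cancel₀ _ hn, mul_div_cancel₀ _ hn', pow_succ' (-1 : ℚ) (n + 1)]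
      simp
  · simp [h1]

/-- `exp (log (1 + (x+y) u)) = 1 + (x+y) u`. -/
lemma expU_logOneAdd : expU (LinearMap.mulLeft ℚ logOneAdd) 1 = 1 + C (x + y) * u := by
  set f := expU (LinearMap.mulLeft ℚ logOneAdd) 1 with hf
  have hr := raisesU_mulLeft uOrderGE_logOneAdd
  have hpow : ∀ k, (LinearMap.mulLeft ℚ logOneAdd ^ k) 1 = logOneAdd ^ k := fun k => by
    rw [LinearMap.pow_mulLeft]; simp
  have hE : eulerU f = eulerU logOneAdd * f := by
    ext e
    rw [coeff_eulerU, hf, coeff_expU hr 1 e le_rfl, Finset.sum_range_succ', MvPowerSeries.coeff_mul]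
    have hc : ∀ ab ∈ Finset.HasAntidiagonal.antidiagonal e,
        MvPowerSeries.coeff ab.1 (eulerU logOneAdd) *
          MvPowerSeries.coeff ab.2 (expU (LinearMap.mulLeft ℚ logOneAdd) 1) =
        ∑ k ∈ Finset.range (e 0), ((k.factorial : ℚ)⁻¹) •
          (MvPowerSeries.coeff ab.1 (eulerU logOneAdd) *
            MvPowerSeries.coeff ab.2 (logOneAdd ^ k)) := by
      intro ab hab
      rw [Finset.HasAntidiagonal.mem_antidiagonal] at hab
      have h0 : ab.1 0 + ab.2 0 = e 0 := by rw [← hab]; rfl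
      rcases Nat.eq_zero_or_pos (ab.1 0) with ha | ha
      · simp [coeff_eulerU, ha]
      · rw [coeff_expU hr 1 ab.2 (M := e 0 - 1) (by omega), Nat.sub_add_cancel (by omega),
          Finset.mul_sum]
        refine Finset.sum_congr rfl fun k _ => ?_
        rw [hpow, mul_smul_comm]
    rw [Finset.sum_congr rfl hc, Finset.sum_comm, smul_add, Finset.smul_sum]
    have hlast : e 0 • (((Nat.factorial 0 : ℚ)⁻¹) • MvPowerSeries.coeff e
        ((LinearMap.mulLeft ℚ logOneAdd ^ 0) 1)) = 0 := by
      classical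
      rw [hpow, pow_zero, MvPowerSeries.coeff_one]
      split_ifs with h
      · simp [h]
      · simp
    rw [hlast, add_zero]
    refine Finset.sum_congr rfl fun k _ => ?_
    rw [← Finset.smul_sum, ← MvPowerSeries.coeff_mul, hpow, smul_comm, ← coeff_eulerU,
      eulerU_pow_logOneAdd, ← Nat.cast_smul_eq_nsmul ℚ, coeff_ratSMul, smul_smul]
    congr 1
    rw [Nat.factorial_succ]
    push_cast
    field_simp
  have hode : (1 + C (x + y) * u) * eulerU f = C (x + y) * u * f := by
    rw [hE, ← mul_assoc, one_add_mul_eulerU_logOneAdd]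
  -- With `z = x + y`, the differential equation reads `n f_n = z f_{n-1} - (n-1) z f_{n-1}`. The
  -- right side vanishes for `n = 2`, and then for all larger `n` because `f_{n-1} = 0`.
  have hrec : ∀ e : Fin 2 →₀ ℕ, 1 ≤ e 0 → e 0 • MvPowerSeries.coeff e f =
      (x + y) * MvPowerSeries.coeff (e - Finsupp.single 0 1) f -
        (e 0 - 1) • ((x + y) * MvPowerSeries.coeff (e - Finsupp.single 0 1) f) := by
    intro e he
    have := congrArg (MvPowerSeries.coeff e) hode
    rw [add_mul, one_mul, map_add, mul_assoc, mul_assoc, coeff_C_mul', coeff_C_mul', coeff_u_mul,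
      coeff_u_mul, if_pos he, if_pos he, coeff_eulerU, coeff_eulerU] at this
    rw [mul_smul_comm, Finsupp.tsub_apply, Finsupp.single_eq_same] at this
    exact eq_sub_of_add_eq this
  have hzero : ∀ e : Fin 2 →₀ ℕ, e 0 = 0 → MvPowerSeries.coeff e f = MvPowerSeries.coeff e 1 := by
    intro e he
    rw [hf, coeff_expU hr 1 e le_rfl, he]
    simp
  have hsmul : ∀ (n : ℕ) (a b : H), (n + 1) • a = (n + 1) • b → a = b := by
    intro n a b h
    rw [← Nat.cast_smul_eq_nsmul ℚ, ← Nat.cast_smul_eq_nsmul ℚ] at h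
    exact smul_right_injective H (by positivity) h
  classical
  have key : ∀ (n : ℕ) (e : Fin 2 →₀ ℕ), e 0 = n →
      MvPowerSeries.coeff e f = MvPowerSeries.coeff e (1 + C (x + y) * u) := by
    intro n
    induction n with
    | zero =>
      intro e he
      rw [hzero e he, map_add, coeff_C_mul', coeff_u, if_neg (by omega)]
      simp
    | succ n ih =>
      intro e he
      have h := hrec e (by omega)
      have h10 : e ≠ 0 := fun h => by simp [h] at he
      rw [ih (e - Finsupp.single 0 1) (by simp [he]), he, map_add, coeff_C_mul', coeff_u, MvPowerSeries.coeff_one] at h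
      have e1 : (e - Finsupp.single 0 1 : Fin 2 →₀ ℕ) 1 = e 1 := by simp
      have e0 : (e - Finsupp.single 0 1 : Fin 2 →₀ ℕ) 0 = e 0 - 1 := by simp
      have e2 : e - Finsupp.single 0 1 = 0 ↔ e 1 = 0 ∧ n = 0 := by
        constructor
        · intro h
          rw [h] at e1 e0
          simp at e1 e0
          omega
        · rintro ⟨h1, h2⟩
          ext i
          fin_cases i <;> simp [h1, h2, he]
      rw [e1, e0, he, Nat.add_sub_cancel] at h
      simp only [e2] at h
      rw [map_add, coeff_C_mul', coeff_u, MvPowerSeries.coeff_one, if_neg h10, he, zero_add]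
      refine hsmul n _ _ (h.trans ?_)
      rcases eq_or_ne (e 1) 0 with h1 | h1
      · rcases n with _ | _ | n
        · simp [h1]
        · simp [h1]
        · simp [h1]
      · simp [h1]
  ext e
  exact key _ e rfl

/-- Write `L` for `logSeries`. Since `logDelta x = yLx`, the operator `A = logDelta - yL·` kills
`x`, while `A(FG) = A(F)G + F logDelta(G)`. Exponentiating on `1 · x` gives `x = exp(A)(1) Δ_u(x)`,
and it remains to see that `exp(A)(1) = 1 + yu`. -/
lemma one_add_mul_Delta_x : (1 + C y * u) * Delta (C x) = C x := by
  set W : S := -(C y * logSeries) with hW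
  have hWo : UOrderGE 1 W := fun e he => by
    rw [hW, map_neg, coeff_C_mul', uOrderGE_logSeries e he, mul_zero, neg_zero]
  set A : S →ₗ[ℚ] S := logDelta + LinearMap.mulLeft ℚ W with hA
  have hAr : RaisesU A := raisesU_logDelta.add (raisesU_mulLeft hWo)
  have hAapp : ∀ F, A F = logDelta F + W * F := fun F => rfl
  have hAmul : ∀ F G, A (F * G) = A F * G + F * logDelta G := by
    intro F G
    rw [hAapp, hAapp, logDelta_mul, add_mul, mul_assoc]
    abel
  have hAx : A (C x) = 0 := by
    rw [hAapp, logDelta_x, hW]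
    simp
  have hDl : ∀ k, logDelta (logSeries * logOneAdd ^ k) = 0 := by
    intro k
    induction k with
    | zero => simpa using logDelta_logSeries
    | succ k ih => rw [pow_succ, ← mul_assoc, logDelta_mul, ih, logDelta_logOneAdd]; simp
  have hcomm : Commute logSeries (C (x + y)) := by
    ext e
    rw [coeff_mul_C', coeff_C_mul', coeff_logSeries]
    split_ifs
    · rw [smul_mul_assoc, mul_smul_comm, ← pow_succ, ← pow_succ']
    · simp
  have hLW : logSeries * C (x + y) = -logOneAdd := by rw [hcomm.eq, logOneAdd, neg_neg]
  have hLc : Commute logOneAdd logSeries :=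
    (hcomm.symm.mul_left (Commute.refl _)).neg_left
  -- `logDelta` kills `L` and `logOneAdd`, so only the leading `y` is differentiated. The two
  -- contributions `yLxL` and `yLyL` combine to `yL(x+y)L`, and `L(x+y) = -logOneAdd`.
  have hpow : ∀ k, (A ^ (k + 1)) 1 = -(C y * (logSeries * logOneAdd ^ k)) := by
    intro k
    induction k with
    | zero =>
      have h1 : logDelta 1 = 0 := logDelta_eq_zero fun l e => by
        classical
        rw [MvPowerSeries.coeff_one]
        split_ifs <;> simp [deriv_one]
      simp [hAapp, h1, hW]
    | succ k ih =>
      have hy : C y = C (x + y) - C x := by rw [map_add]; abel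
      rw [pow_succ', Module.End.mul_apply, ih, hAapp, map_neg, logDelta_mul, hDl, logDelta_y, hW,
        mul_zero, add_zero]
      have h2 : C y * logSeries * (C y * (logSeries * logOneAdd ^ k)) =
          -(C y * (logSeries * logOneAdd ^ (k + 1))) -
            C y * logSeries * C x * (logSeries * logOneAdd ^ k) := by
        have h3 : C y * logSeries * (C y * (logSeries * logOneAdd ^ k)) =
            C y * logSeries * ((C (x + y) - C x) * (logSeries * logOneAdd ^ k)) := by rw [← hy]
        rw [h3, sub_mul, mul_sub, ← mul_assoc, mul_assoc (C y) logSeries (C (x + y)), hLW,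
          pow_succ', ← mul_assoc logSeries, ← hLc.eq, ← mul_assoc (C y * logSeries)]
        simp only [mul_assoc, neg_mul, mul_neg]
      rw [neg_mul_neg, h2]
      simp
  have hexp : expU A 1 = 1 + C y * u := by
    ext e
    have hlog := congrArg (MvPowerSeries.coeff e) expU_logOneAdd
    have hr := raisesU_mulLeft uOrderGE_logOneAdd
    rw [coeff_expU hr 1 e le_rfl, Finset.sum_range_succ', map_add, coeff_C_mul'] at hlog
    rw [coeff_expU hAr 1 e le_rfl, Finset.sum_range_succ', map_add, coeff_C_mul']
    simp only [pow_zero, Module.End.one_apply, Nat.factorial_zero, Nat.cast_one, inv_one,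
      one_smul] at hlog ⊢
    rw [add_comm, add_left_cancel_iff] at hlog ⊢
    have hz : (x + y : H) ≠ 0 := by
      intro h
      have := congrArg (FreeAlgebra.lift ℚ (fun a => match a with
        | Letter.x => (1 : ℚ)
        | Letter.y => 0)) h
      simp [x, y] at this
    -- The exponential series of `logOneAdd` contains the wanted sum with a factor `x + y` on the
    -- left; it can be cancelled because the free algebra has no zero divisors.
    have hsum : (x + y) * ∑ k ∈ Finset.range (e 0), (((k + 1).factorial : ℚ)⁻¹) •
        MvPowerSeries.coeff e (logSeries * logOneAdd ^ k) =
        (x + y) * -MvPowerSeries.coeff e u := by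
      rw [mul_neg, ← hlog, Finset.mul_sum, ← Finset.sum_neg_distrib]
      refine Finset.sum_congr rfl fun k _ => ?_
      rw [LinearMap.pow_mulLeft, LinearMap.mulLeft_apply, mul_one, pow_succ', mul_smul_comm,
        ← coeff_C_mul', ← mul_assoc, logOneAdd, neg_mul, map_neg, smul_neg, neg_neg]
    have hs := mul_left_cancel₀ hz hsum
    have hneg : MvPowerSeries.coeff e u = -∑ k ∈ Finset.range (e 0), (((k + 1).factorial : ℚ)⁻¹) •
        MvPowerSeries.coeff e (logSeries * logOneAdd ^ k) := by rw [hs, neg_neg]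
    rw [hneg, mul_neg, Finset.mul_sum, ← Finset.sum_neg_distrib]
    refine Finset.sum_congr rfl fun k _ => ?_
    rw [hpow, map_neg, coeff_C_mul', smul_neg, mul_smul_comm]
  have h := expU_mul hAr hAr raisesU_logDelta hAmul 1 (C x)
  rw [one_mul, expU_of_apply_eq_zero hAr hAx, hexp] at h
  exact h.symm

lemma inv_mul_self {F : S} (h : MvPowerSeries.constantCoeff F = 1) : inv F * F = 1 :=
  MvPowerSeries.invOfUnit_mul F 1 h

/-- `Δ_u(x) = 1/(1+yu) x`. -/
lemma Delta_x : Delta (C x) = inv (1 + C y * u) * C x := by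
  have h : inv (1 + C y * u) * (1 + C y * u) = 1 := inv_mul_self (by simp [u])
  rw [← one_add_mul_Delta_x, ← mul_assoc, h, one_mul, one_add_mul_Delta_x]

/-- `Δ_u(x + y) = x + y`. -/
lemma Delta_x_add_y : Delta (C (x + y)) = C (x + y) := by
  refine expU_of_apply_eq_zero raisesU_logDelta ?_
  rw [map_add, map_add, logDelta_x, logDelta_y]
  simp

/-! ### Matrices for the letters

Over a commutative ring with inverses `c j` of `1 ≤ j < p`, the letters act on column vectors
indexed by `0, …, p - 1`. A vector is the list of values of a functional at the powers
`(t/(1-t))^k`; the letters `x` and `y` are transposes of integration against `dt/t` and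
`dt/(1-t)`. -/

section Matrices

variable {K : Type*} [CommRing K] (p : ℕ) (c : ℕ → K)

/-- The matrix of `b ↦ (b_{k+1})_k`. -/
def shiftMat (K : Type*) [CommRing K] (p : ℕ) : Matrix (Fin p) (Fin p) K :=
  Matrix.of fun i j => if (j : ℕ) = i + 1 then 1 else 0

/-- The inverse of `1 + shiftMat`. -/
def altMat (K : Type*) [CommRing K] (p : ℕ) : Matrix (Fin p) (Fin p) K :=
  Matrix.of fun i j => if (i : ℕ) ≤ j then (-1) ^ ((j : ℕ) - i) else 0

/-- The diagonal matrix with entries `b 0, …, b (p-1)`. -/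
def diagMat (p : ℕ) (b : ℕ → K) : Matrix (Fin p) (Fin p) K := Matrix.diagonal fun i => b i

/-- The matrix of the letter `x`. -/
def xMat : Matrix (Fin p) (Fin p) K := altMat K p * diagMat p c

/-- The matrix of the letter `y`. -/
def yMat : Matrix (Fin p) (Fin p) K := altMat K p * (shiftMat K p * diagMat p c)

/-- The vector of the first `p` terms of a sequence. -/
def vec (b : ℕ → K) : Fin p → K := fun i => b i

variable {p c}

lemma shiftMat_mul_apply (M : Matrix (Fin p) (Fin p) K) (i j : Fin p) :
    (shiftMat K p * M) i j = if h : (i : ℕ) + 1 < p then M ⟨i + 1, h⟩ j else 0 := by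
  rw [Matrix.mul_apply]
  simp only [shiftMat, Matrix.of_apply, ite_mul, one_mul, zero_mul]
  split_ifs with h
  · rw [Finset.sum_eq_single ⟨i + 1, h⟩]
    · simp
    · intro k _ hk
      exact if_neg fun h' => hk (Fin.ext h')
    · simp
  · exact Finset.sum_eq_zero fun k _ => if_neg fun h' => h (by omega)

lemma shiftMat_mulVec {b : ℕ → K} (hb : b p = 0) :
    (shiftMat K p).mulVec (vec p b) = vec p fun k => b (k + 1) := by
  funext i
  simp only [Matrix.mulVec, dotProduct, shiftMat, Matrix.of_apply, ite_mul, one_mul, zero_mul, vec]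
  by_cases h : (i : ℕ) + 1 < p
  · rw [Finset.sum_eq_single ⟨i + 1, h⟩]
    · simp
    · intro k _ hk
      exact if_neg fun h' => hk (Fin.ext h')
    · simp
  · have hi : (i : ℕ) + 1 = p := by omega
    rw [hi, hb]
    exact Finset.sum_eq_zero fun k _ => if_neg fun h' => h (by omega)

lemma diagMat_mulVec (b d : ℕ → K) :
    (diagMat p b).mulVec (vec p d) = vec p fun k => b k * d k := by
  funext i
  simp [diagMat, Matrix.mulVec_diagonal, vec]

lemma one_add_shiftMat_mul_altMat : (1 + shiftMat K p) * altMat K p = 1 := by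
  ext i j
  rw [add_mul, one_mul, Matrix.add_apply, shiftMat_mul_apply, Matrix.one_apply]
  simp only [altMat, Matrix.of_apply]
  rcases lt_trichotomy (i : ℕ) j with h | h | h
  · have hi : (i : ℕ) + 1 < p := by omega
    rw [if_pos h.le, dif_pos hi, if_pos (by omega), if_neg (by rintro rfl; omega)]
    rw [show (j : ℕ) - i = (j - (i + 1)) + 1 by omega, pow_succ]
    ring
  · obtain rfl := Fin.ext h
    simp
  · have h1 : ¬((i : ℕ) + 1 ≤ j) := by omega
    have h2 : i ≠ j := by rintro rfl; omega
    simp only [if_neg (show ¬((i : ℕ) ≤ j) by omega), if_neg h1, if_neg h2, dite_eq_ite, ite_self,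
      add_zero]

lemma altMat_mul_one_add_shiftMat : altMat K p * (1 + shiftMat K p) = 1 :=
  mul_eq_one_comm.1 one_add_shiftMat_mul_altMat

lemma one_add_shiftMat_mul_xMat : (1 + shiftMat K p) * xMat p c = diagMat p c := by
  rw [xMat, ← mul_assoc, one_add_shiftMat_mul_altMat, one_mul]

lemma one_add_shiftMat_mul_yMat :
    (1 + shiftMat K p) * yMat p c = shiftMat K p * diagMat p c := by
  rw [yMat, ← mul_assoc, one_add_shiftMat_mul_altMat, one_mul]

lemma xMat_add_yMat : xMat p c + yMat p c = diagMat p c := by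
  calc xMat p c + yMat p c = altMat K p * (1 + shiftMat K p) * diagMat p c := by
        rw [xMat, yMat]; noncomm_ring
    _ = diagMat p c := by rw [altMat_mul_one_add_shiftMat, one_mul]

lemma one_add_shiftMat_cancel {f g : Fin p → K}
    (h : (1 + shiftMat K p).mulVec f = (1 + shiftMat K p).mulVec g) : f = g := by
  have := congrArg (altMat K p).mulVec h
  simpa only [Matrix.mulVec_mulVec, altMat_mul_one_add_shiftMat, Matrix.one_mulVec] using this

lemma one_add_shiftMat_mulVec {b : ℕ → K} (hb : b p = 0) :
    (1 + shiftMat K p).mulVec (vec p b) = vec p fun k => b k + b (k + 1) := by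
  rw [Matrix.add_mulVec, Matrix.one_mulVec, shiftMat_mulVec hb]
  rfl

lemma vec_congr {L : Type*} {a b : ℕ → L} (h : ∀ k < p, a k = b k) : vec p a = vec p b :=
  funext fun i => h i i.2

/-- The action of `x`, characterised by a recursion. -/
lemma xMat_mulVec {a b : ℕ → K} (ha : a p = 0) (h : ∀ k < p, a k + a (k + 1) = c k * b k) :
    (xMat p c).mulVec (vec p b) = vec p a := by
  refine one_add_shiftMat_cancel ?_
  rw [Matrix.mulVec_mulVec, one_add_shiftMat_mul_xMat, one_add_shiftMat_mulVec ha, diagMat_mulVec]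
  exact vec_congr fun k hk => (h k hk).symm

/-- The action of `y`, characterised by a recursion. -/
lemma yMat_mulVec {a b : ℕ → K} (ha : a p = 0) (hb : b p = 0)
    (h : ∀ k < p, a k + a (k + 1) = c (k + 1) * b (k + 1)) :
    (yMat p c).mulVec (vec p b) = vec p a := by
  refine one_add_shiftMat_cancel ?_
  rw [Matrix.mulVec_mulVec, one_add_shiftMat_mul_yMat, one_add_shiftMat_mulVec ha,
    ← Matrix.mulVec_mulVec, diagMat_mulVec, shiftMat_mulVec (by simp [hb])]
  exact vec_congr fun k hk => (h k hk).symm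

/-! ### The intertwining operator -/

/-- The product `∏_{j=1}^{k} (1 + s c_j)`. -/
def risingProd (c : ℕ → K) (s : K) (k : ℕ) : K := ∏ j ∈ Finset.range k, (1 + s * c (j + 1))

@[simp] lemma risingProd_zero (s : K) : risingProd c s 0 = 1 := by simp [risingProd]

lemma risingProd_succ (s : K) (k : ℕ) :
    risingProd c s (k + 1) = risingProd c s k * (1 + s * c (k + 1)) := Finset.prod_range_succ _ _

lemma diagMat_comm (a b : ℕ → K) : diagMat p a * diagMat p b = diagMat p b * diagMat p a := by
  simp [diagMat, mul_comm]

/-- The recursion of `risingProd` moves the diagonal matrix past the shift at the cost of the term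
`s S diag(c)`, which equals `s (1+S) Y`. -/
lemma one_add_shiftMat_mul_risingProd (s : K) :
    (1 + shiftMat K p) * diagMat p (risingProd c s) =
      diagMat p (risingProd c s) * (1 + shiftMat K p) * (1 + s • yMat p c) := by
  have h : shiftMat K p * diagMat p (risingProd c s) =
      diagMat p (risingProd c s) * (shiftMat K p + s • (shiftMat K p * diagMat p c)) := by
    ext i j
    simp only [diagMat, Matrix.mul_diagonal, Matrix.diagonal_mul, Matrix.add_apply,
      Matrix.smul_apply, shiftMat, Matrix.of_apply, smul_eq_mul]
    split_ifs with hij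
    · rw [hij, risingProd_succ]; ring
    · simp
  rw [mul_assoc, mul_add (1 + shiftMat K p), mul_one, mul_smul_comm, one_add_shiftMat_mul_yMat,
    add_mul, one_mul, h]
  noncomm_ring

/-- `A X` represents `Δ_u(x) = (1+yu)⁻¹x`. After multiplication by the invertible `1 + S`, both
sides are products of the same two diagonal matrices. -/
lemma risingProd_mul_xMat {s : K} {A : Matrix (Fin p) (Fin p) K}
    (hA : (1 + s • yMat p c) * A = 1) :
    diagMat p (risingProd c s) * (A * xMat p c) = xMat p c * diagMat p (risingProd c s) := by
  have h : (1 + shiftMat K p) * (diagMat p (risingProd c s) * (A * xMat p c)) =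
      (1 + shiftMat K p) * (xMat p c * diagMat p (risingProd c s)) := by
    calc _ = diagMat p (risingProd c s) * (1 + shiftMat K p) * ((1 + s • yMat p c) * A) *
          xMat p c := by
          rw [← mul_assoc (1 + shiftMat K p), one_add_shiftMat_mul_risingProd]
          simp only [mul_assoc]
      _ = _ := by
          rw [hA, mul_one, mul_assoc, one_add_shiftMat_mul_xMat, ← mul_assoc,
            one_add_shiftMat_mul_xMat, diagMat_comm]
  have := congrArg (altMat K p * ·) h
  simpa only [← mul_assoc, altMat_mul_one_add_shiftMat, one_mul] using this

/-- The sum of the two letters is diagonal, hence commutes with `diagMat`; the rest is the case of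
`x`. -/
lemma risingProd_mul_yMat {s : K} {A : Matrix (Fin p) (Fin p) K}
    (hA : (1 + s • yMat p c) * A = 1) :
    diagMat p (risingProd c s) * (xMat p c + yMat p c - A * xMat p c) =
      yMat p c * diagMat p (risingProd c s) := by
  rw [mul_sub, risingProd_mul_xMat hA, xMat_add_yMat, diagMat_comm, ← xMat_add_yMat, add_mul]
  abel

/-! ### The key identity -/

lemma cast_mul_choose_succ (p i : ℕ) (hi : i ≤ p) :
    ((i : K) + 1) * (p.choose (i + 1) : K) = ((p : K) - i) * (p.choose i : K) := by
  have h := Nat.choose_succ_right_eq p i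
  have := congrArg (Nat.cast (R := K)) h
  push_cast [Nat.cast_sub hi] at this
  rw [mul_comm, this, mul_comm]

lemma cast_mul_choose_pred (p i : ℕ) (hp : 1 ≤ p) (hi : i ≤ p) :
    (p : K) * ((p - 1).choose i : K) = ((p : K) - i) * (p.choose i : K) := by
  obtain ⟨q, rfl⟩ : ∃ q, p = q + 1 := ⟨p - 1, by omega⟩
  rw [← cast_mul_choose_succ _ _ hi]
  have h := Nat.add_one_mul_choose_eq q i
  have := congrArg (Nat.cast (R := K)) h
  push_cast at this
  rw [Nat.add_sub_cancel]
  push_cast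
  rw [this, mul_comm]

/-- The vector of binomial coefficients: the functional that sums the coefficients. -/
def binomVec (K : Type*) [CommRing K] (p : ℕ) : Fin p → K := vec p fun k => ((p - 1).choose k : K)

/-- With `ν = DAλ`, the second equation is `(1+sX)(1-pX)σ = spXν`, so `Yσ` is the correction term at
`v = p`, and the first equation evaluates it. Here `σ` has a closed form, and both equations are
checked by the recursions that characterise `X` and `Y`. -/
lemma exists_key_identity (hp : 1 ≤ p) (hc0 : c 0 = 0) (hc : ∀ j, 1 ≤ j → j < p → (j : K) * c j = 1)
    {s : K} {A : Matrix (Fin p) (Fin p) K} (hA : (1 + s • yMat p c) * A = 1) :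
    ∃ σ : Fin p → K,
      (yMat p c).mulVec σ = (diagMat p (risingProd c s)).mulVec (A.mulVec (binomVec K p)) -
        risingProd c s (p - 1) • binomVec K p ∧
      σ + (s - p) • (xMat p c).mulVec σ - (s * p) • (xMat p c).mulVec ((xMat p c).mulVec σ) =
        (s * p) • (xMat p c).mulVec
          ((diagMat p (risingProd c s)).mulVec (A.mulVec (binomVec K p))) := by
  set g := risingProd c s with hg
  set μ : ℕ → K := fun k => if h : k < p then A.mulVec (binomVec K p) ⟨k, h⟩ else 0 with hμ
  have hμv : A.mulVec (binomVec K p) = vec p μ := by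
    funext i
    simp [vec, hμ]
  have hμp : μ p = 0 := by simp [hμ]
  have hchp : ((p - 1).choose p : K) = 0 := by
    rw [Nat.choose_eq_zero_of_lt (by omega), Nat.cast_zero]
  have hpascal : ∀ k, ((p - 1).choose k : K) + ((p - 1).choose (k + 1) : K) =
      (p.choose (k + 1) : K) := by
    intro k
    obtain ⟨q, rfl⟩ : ∃ q, p = q + 1 := ⟨p - 1, by omega⟩
    rw [Nat.add_sub_cancel, Nat.choose_succ_succ]
    push_cast
    rfl
  -- The equation `(1+sY)μ = λ` multiplied by `1 + S`; Pascal's rule turns `(1+S)λ` into binomial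
  -- coefficients of `p`.
  have hμrec : ∀ k < p, μ k + μ (k + 1) * (1 + s * c (k + 1)) = (p.choose (k + 1) : K) := by
    intro k hk
    have h1 : (1 + s • yMat p c).mulVec (vec p μ) = binomVec K p := by
      rw [← hμv, Matrix.mulVec_mulVec, hA, Matrix.one_mulVec]
    have h2 := congrArg (1 + shiftMat K p).mulVec h1
    rw [Matrix.add_mulVec 1 (s • yMat p c), Matrix.one_mulVec, Matrix.mulVec_add,
      Matrix.smul_mulVec, Matrix.mulVec_smul, Matrix.mulVec_mulVec, one_add_shiftMat_mul_yMat,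
      ← Matrix.mulVec_mulVec, diagMat_mulVec, shiftMat_mulVec (by simp [hμp]),
      one_add_shiftMat_mulVec hμp, binomVec,
      one_add_shiftMat_mulVec (b := fun k => ((p - 1).choose k : K)) hchp] at h2
    have h3 := congrFun h2 ⟨k, hk⟩
    simp only [vec, Pi.add_apply, Pi.smul_apply, smul_eq_mul, hpascal] at h3
    rw [← h3]
    ring
  set d : ℕ → K := fun k => g (p - 1) * ((p - 1).choose k : K) - g k * μ k with hd
  have hdp : d p = 0 := by simp [hd, hμp, hchp]
  have hdrec : ∀ k < p, d k + d (k + 1) = (p.choose (k + 1) : K) * (g (p - 1) - g k) := by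
    intro k hk
    simp only [hd]
    rw [hg, risingProd_succ, ← hg, ← hpascal]
    have h := hμrec k hk
    rw [← hpascal] at h
    linear_combination (-(g k)) * h
  -- `Yσ = -d` requires `c_{k+1} σ_{k+1} = -(d_k + d_{k+1})`, and `1/c_{k+1} = k + 1` suggests these
  -- values. `Y` does not see `σ_0`; since `c_0 = 0`, the second equation forces `σ_0 = -σ_1`.
  set σ' : ℕ → K := fun k => -((k : K) * ((p.choose k : K) * (g (p - 1) - g (k - 1)))) with hσ'
  set σ : ℕ → K := fun k => if k = 0 then -σ' 1 else σ' k with hσ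
  have hσ0 : σ 0 = -σ 1 := by simp [hσ]
  have hσs : ∀ k, σ (k + 1) = -(((k : K) + 1) * ((p.choose (k + 1) : K) * (g (p - 1) - g k))) := by
    intro k
    simp [hσ, hσ']
  have hσp : σ p = 0 := by
    obtain ⟨q, hq⟩ : ∃ q, p = q + 1 := ⟨p - 1, by omega⟩
    rw [hq, hσs, ← hq, hq, Nat.add_sub_cancel, sub_self, mul_zero, mul_zero, neg_zero]
  have hcσ : ∀ k < p, c (k + 1) * σ (k + 1) = -(d k + d (k + 1)) := by
    intro k hk
    rw [hσs, hdrec k hk]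
    rcases Nat.lt_or_ge (k + 1) p with h | h
    · have h1 := hc (k + 1) (by omega) h
      push_cast at h1
      linear_combination (-((p.choose (k + 1) : K) * (g (p - 1) - g k))) * h1
    -- Nothing is known about `c p`, but the factor `g (p - 1) - g k` is zero here.
    · have hk' : p - 1 = k := by omega
      rw [hk', sub_self]
      ring
  -- `a` is `Xσ`: the recursion `a_k + a_{k+1} = c_k σ_k = -(d_{k-1} + d_k)` is solved by `-d`
  -- shifted by one place, with `a_0 = -a_1` because `c_0 = 0`.
  set a : ℕ → K := fun k => if k = 0 then d 0 else -d (k - 1) with ha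
  have ha0 : a 0 = d 0 := rfl
  have has : ∀ k, a (k + 1) = -d k := fun k => rfl
  have hap : a p = 0 := by
    obtain ⟨q, hq⟩ : ∃ q, p = q + 1 := ⟨p - 1, by omega⟩
    have h := hcσ q (by omega)
    rw [← hq, hσp, hdp, mul_zero] at h
    rw [hq, has]
    linear_combination -h
  have hY : (yMat p c).mulVec (vec p σ) = vec p fun k => -d k := by
    refine yMat_mulVec (by simp [hdp]) hσp fun k hk => ?_
    rw [hcσ k hk]
    ring
  have hX : (xMat p c).mulVec (vec p σ) = vec p a := by
    refine xMat_mulVec hap fun k hk => ?_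
    rcases k with _ | k
    · rw [ha0, has, hc0]; ring
    · rw [has, has, hcσ k (by omega)]; ring
  have hXX : (xMat p c).mulVec (vec p fun k => s * p * (a k + g k * μ k)) =
      vec p fun k => σ k + (s - p) * a k := by
    refine xMat_mulVec (by rw [hσp, hap]; ring) fun k hk => ?_
    rcases k with _ | k
    · rw [hσ0, hc0, ha0, has]; ring
    · have h1 := hc (k + 1) (by omega) hk
      -- The recursion multiplied by `k + 1`, so that no inverse remains. It follows from `(k+1)
      -- g_{k+1} = (k+1+s) g_k` and two absorption identities for binomial coefficients.
      have hcond : ((k : K) + 1) * (σ (k + 1) + (s - p) * a (k + 1) +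
          (σ (k + 1 + 1) + (s - p) * a (k + 1 + 1))) =
          s * p * (a (k + 1) + g (k + 1) * μ (k + 1)) := by
        have e1 := hdrec k (by omega)
        have e2 := cast_mul_choose_succ (K := K) p (k + 1) (by omega)
        have e3 := cast_mul_choose_pred (K := K) p (k + 1) hp (by omega)
        have e4 : ((k : K) + 1) * g (k + 1) = ((k : K) + 1 + s) * g k := by
          rw [hg, risingProd_succ]
          push_cast at h1
          linear_combination (s * risingProd c s k) * h1
        have e5 : d (k + 1) = g (p - 1) * ((p - 1).choose (k + 1) : K) - g (k + 1) * μ (k + 1) :=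
          rfl
        rw [has, has, hσs, hσs]
        push_cast at e2 e3 ⊢
        set b : K := (p.choose (k + 1) : K)
        set G := g (p - 1)
        linear_combination (-((k : K) + 1) * (s - p) - s * p + s * p) * e1 - s * p * e5 +
          (-((k : K) + 1) * (G - g (k + 1))) * e2 - s * G * e3 + (p - (k + 1)) * b * e4 +
          s * p * e1
      push_cast at h1
      linear_combination (-(σ (k + 1) + (s - p) * a (k + 1) +
          (σ (k + 1 + 1) + (s - p) * a (k + 1 + 1)))) * h1 + c (k + 1) * hcond
  have hν : (diagMat p g).mulVec (A.mulVec (binomVec K p)) = vec p fun k => g k * μ k := by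
    rw [hμv, diagMat_mulVec]
  refine ⟨vec p σ, ?_, ?_⟩
  · rw [hY, hν]
    funext i
    simp only [vec, hd, binomVec, Pi.sub_apply, Pi.smul_apply, smul_eq_mul]
    ring
  · rw [hX, hν, sub_eq_iff_eq_add, ← smul_add, ← Matrix.mulVec_add, ← Matrix.mulVec_smul]
    have e : (s * p : K) • ((vec p fun k => g k * μ k) + vec p a) =
        vec p fun k => s * p * (a k + g k * μ k) := by
      funext i
      simp only [vec, Pi.add_apply, Pi.smul_apply, smul_eq_mul]
      ring
    rw [e, hXX]
    rfl

end Matrices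

/-! ### The matrix identity modulo `p - r` -/

section Twist

variable {K : Type*} [CommRing K] {p : ℕ} {c : ℕ → K}

lemma intertwine_inverse {M : Type*} [Ring M] {D P P' Q Q' : M} (h : D * P' = P * D)
    (hQ : Q * P = 1) (hQ' : P' * Q' = 1) : D * Q' = Q * D := by
  calc D * Q' = Q * P * (D * Q') := by rw [hQ, one_mul]
    _ = Q * (D * P') * Q' := by rw [h]; noncomm_ring
    _ = Q * D * (P' * Q') := by noncomm_ring
    _ = Q * D := by rw [hQ', mul_one]

/-- The matrix form of the theorem: up to multiples of `p - r`, twisting the letters and correcting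
the twisted word amounts to multiplication by `∏ (1 + s/j)`. -/
lemma exists_twist (hp : 1 ≤ p) (hc0 : c 0 = 0)
    (hc : ∀ j, 1 ≤ j → j < p → (j : K) * c j = 1) {s r : K}
    {A B E B' E' W W' : Matrix (Fin p) (Fin p) K}
    (hA : (1 + s • yMat p c) * A = 1) (hB : B * (1 + s • xMat p c) = 1)
    (hE : E * (1 - r • xMat p c) = 1) (hB' : (1 + s • (A * xMat p c)) * B' = 1)
    (hE' : (1 - r • (A * xMat p c)) * E' = 1)
    (hW : diagMat p (risingProd c s) * W' = W * diagMat p (risingProd c s)) :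
    ∃ J : Fin p → K, (diagMat p (risingProd c s)).mulVec ((W' *
      (1 - (s • (xMat p c + yMat p c - A * xMat p c)) * B' * ((r • (A * xMat p c)) * E')) *
        A).mulVec (binomVec K p)) =
      W.mulVec (risingProd c s (p - 1) • binomVec K p + ((p : K) - r) • J) := by
  obtain ⟨σ, hσY, hσX⟩ := exists_key_identity hp hc0 hc hA
  set D := diagMat p (risingProd c s) with hD
  set X := xMat p c with hX
  set Y := yMat p c with hY
  set ν := D.mulVec (A.mulVec (binomVec K p)) with hν
  have hDX : D * (A * X) = X * D := risingProd_mul_xMat hA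
  have hDY : D * (X + Y - A * X) = Y * D := risingProd_mul_yMat hA
  have hDB : D * B' = B * D := intertwine_inverse
    (by rw [mul_add, add_mul, mul_one, one_mul, mul_smul_comm, smul_mul_assoc, hDX]) hB hB'
  have hDE : D * E' = E * D := intertwine_inverse
    (by rw [mul_sub, sub_mul, mul_one, one_mul, mul_smul_comm, smul_mul_assoc, hDX]) hE hE'
  have hEX : E * X = X * E := by
    have hE2 : (1 - r • X) * E = 1 := mul_eq_one_comm.1 hE
    refine (intertwine_inverse (D := X) ?_ hE hE2).symm
    rw [mul_sub, sub_mul, mul_one, one_mul, mul_smul_comm, smul_mul_assoc]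
  -- Carrying `D` from left to right replaces every twisted letter by the original one.
  have hcomm : D * (W' * (1 - (s • (X + Y - A * X)) * B' * ((r • (A * X)) * E')) * A) =
      W * (1 - (s * r) • (Y * B * E * X)) * (D * A) := by
    have h1 : D * ((s • (X + Y - A * X)) * B' * ((r • (A * X)) * E')) =
        (s * r) • (Y * B * E * X) * D := by
      calc _ = (s * r) • (D * (X + Y - A * X) * B' * (A * X) * E') := by
            simp only [smul_mul_assoc, mul_smul_comm, smul_smul, mul_assoc, mul_comm r s]
        _ = (s * r) • (Y * (D * B') * (A * X) * E') := by rw [hDY]; simp only [mul_assoc]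
        _ = (s * r) • (Y * B * (D * (A * X)) * E') := by rw [hDB]; simp only [mul_assoc]
        _ = (s * r) • (Y * B * X * (D * E')) := by rw [hDX]; simp only [mul_assoc]
        _ = (s * r) • (Y * B * (X * E) * D) := by rw [hDE]; simp only [mul_assoc]
        _ = _ := by rw [← hEX, smul_mul_assoc]; simp only [mul_assoc]
    calc _ = D * W' * (1 - (s • (X + Y - A * X)) * B' * ((r • (A * X)) * E')) * A := by
          simp only [mul_assoc]
      _ = W * (D * (1 - (s • (X + Y - A * X)) * B' * ((r • (A * X)) * E'))) * A := by
          rw [hW]; simp only [mul_assoc]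
      _ = _ := by
          rw [mul_sub D, mul_one, h1, mul_assoc W, mul_assoc W]
          congr 1
          rw [← mul_assoc, sub_mul 1, one_mul]
  -- Replacing `p` by `r` in `(1+sX)(1-pX)σ = spXν` changes both sides by multiples of `p - r`; `κ`
  -- collects them.
  set κ := X.mulVec σ + s • X.mulVec (X.mulVec σ) + s • X.mulVec ν with hκ
  refine ⟨Y.mulVec (B.mulVec (E.mulVec κ)), ?_⟩
  have hXν : (s * r) • X.mulVec ν = (1 - r • X).mulVec ((1 + s • X).mulVec σ) -
      ((p : K) - r) • κ := by
    simp only [Matrix.sub_mulVec, Matrix.add_mulVec, Matrix.one_mulVec, Matrix.smul_mulVec,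
      Matrix.mulVec_add, Matrix.mulVec_smul, hκ]
    funext i
    have h := congrFun hσX i
    simp only [Pi.add_apply, Pi.sub_apply, Pi.smul_apply, smul_eq_mul] at h ⊢
    linear_combination -h
  have hEB : B.mulVec (E.mulVec ((1 - r • X).mulVec ((1 + s • X).mulVec σ))) = σ := by
    rw [Matrix.mulVec_mulVec _ E, hE, Matrix.one_mulVec, Matrix.mulVec_mulVec, hB,
      Matrix.one_mulVec]
  have hmain : (s * r) • (Y * B * E * X).mulVec ν =
      Y.mulVec σ - ((p : K) - r) • Y.mulVec (B.mulVec (E.mulVec κ)) := by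
    rw [← Matrix.mulVec_mulVec, ← Matrix.mulVec_mulVec, ← Matrix.mulVec_mulVec,
      ← Matrix.mulVec_smul, ← Matrix.mulVec_smul, ← Matrix.mulVec_smul, hXν]
    simp only [Matrix.mulVec_sub, Matrix.mulVec_smul, hEB]
  rw [Matrix.mulVec_mulVec, hcomm, ← Matrix.mulVec_mulVec, ← Matrix.mulVec_mulVec]
  congr 1
  rw [← Matrix.mulVec_mulVec, ← hν, Matrix.sub_mulVec, Matrix.one_mulVec, Matrix.smul_mulVec,
    hmain, hσY]
  abel

end Twist

/-! ### The integral form of the twisted words -/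

/-- The ring `ℤ⟨x, y⟩`. -/
abbrev HZ : Type := FreeAlgebra ℤ Letter

/-- The ring homomorphism from `ℤ⟨x, y⟩` with prescribed values at the letters. -/
noncomputable def letterHom {M : Type*} [Ring M] (a b : M) : HZ →+* M :=
  (FreeAlgebra.lift ℤ fun
    | Letter.x => a
    | Letter.y => b).toRingHom

/-- The letter `x` of `ℤ⟨x, y⟩`. -/
noncomputable def xZ : HZ := FreeAlgebra.ι ℤ Letter.x

/-- The letter `y` of `ℤ⟨x, y⟩`. -/
noncomputable def yZ : HZ := FreeAlgebra.ι ℤ Letter.y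

lemma letterHom_x {M : Type*} [Ring M] (a b : M) : letterHom a b xZ = a := by
  simp [letterHom, xZ]

lemma letterHom_y {M : Type*} [Ring M] (a b : M) : letterHom a b yZ = b := by
  simp [letterHom, yZ]

lemma HZ_hom_ext {M : Type*} [Ring M] {f g : HZ →+* M} (hx : f xZ = g xZ) (hy : f yZ = g yZ) :
    f = g := by
  have h : f.toIntAlgHom = g.toIntAlgHom := by
    apply FreeAlgebra.hom_ext
    funext i
    cases i
    · exact hx
    · exact hy
  ext a
  exact DFunLike.congr_fun h a

/-- An element that intertwines the values of two homomorphisms at the letters intertwines the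
homomorphisms. -/
lemma intertwine_letterHom {M : Type*} [Ring M] {D a b a' b' : M} (ha : D * a' = a * D)
    (hb : D * b' = b * D) (w : HZ) : D * letterHom a' b' w = letterHom a b w * D := by
  induction w using FreeAlgebra.induction with
  | grade0 n =>
    have h1 : ∀ f : HZ →+* M, f (algebraMap ℤ HZ n) = (n : M) := fun f => by simp
    rw [h1, h1, Int.cast_comm]
  | grade1 i =>
    cases i
    · exact (congrArg (D * ·) (letterHom_x a' b')).trans
        (ha.trans (congrArg (· * D) (letterHom_x a b)).symm)
    · exact (congrArg (D * ·) (letterHom_y a' b')).trans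
        (hb.trans (congrArg (· * D) (letterHom_y a b)).symm)
  | mul f g hf hg => rw [map_mul, map_mul, ← mul_assoc, hf, mul_assoc, hg, mul_assoc]
  | add f g hf hg => rw [map_add, map_add, mul_add, hf, hg, add_mul]

section Twisted

variable {M : Type*} [Ring M]

/-- The inverse of a power series with constant coefficient `1`. -/
noncomputable def invOne (F : MvPowerSeries (Fin 2) M) : MvPowerSeries (Fin 2) M :=
  MvPowerSeries.invOfUnit F 1

lemma invOne_mul {F : MvPowerSeries (Fin 2) M} (h : MvPowerSeries.constantCoeff F = 1) :
    invOne F * F = 1 := MvPowerSeries.invOfUnit_mul F 1 h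

lemma mul_invOne {F : MvPowerSeries (Fin 2) M} (h : MvPowerSeries.constantCoeff F = 1) :
    F * invOne F = 1 := MvPowerSeries.mul_invOfUnit F 1 h

lemma eq_invOne {N : Type*} [Ring N] (f : MvPowerSeries (Fin 2) M →+* N)
    {F : MvPowerSeries (Fin 2) M} {g : N} (h : MvPowerSeries.constantCoeff F = 1)
    (hg : g * f F = 1) : f (invOne F) = g := by
  calc f (invOne F) = g * f F * f (invOne F) := by rw [hg, one_mul]
    _ = g * f (F * invOne F) := by rw [map_mul, mul_assoc]
    _ = g := by rw [mul_invOne h, map_one, mul_one]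

end Twisted

/-- `ℤ⟨x, y⟩[[u, v]]`. -/
abbrev SZ : Type := MvPowerSeries (Fin 2) HZ

/-- `1/(1 + yu)`. -/
noncomputable def invYZ : SZ := invOne (1 + MvPowerSeries.C yZ * MvPowerSeries.X 0)

/-- The value `1/(1+yu) x` of `Δ_u` at `x`. -/
noncomputable def xDelta : SZ := invYZ * MvPowerSeries.C xZ

/-- The value of `Δ_u` at `y`. -/
noncomputable def yDelta : SZ := MvPowerSeries.C (xZ + yZ) - xDelta

/-- The series `R_x⁻¹ Δ_u R_x (w - w yu/(1+xu) xv/(1-xv))`. -/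
noncomputable def twisted (w : HZ) : SZ :=
  letterHom xDelta yDelta w *
    (1 - yDelta * MvPowerSeries.X 0 * invOne (1 + xDelta * MvPowerSeries.X 0) *
      ((xDelta * MvPowerSeries.X 1) * invOne (1 - xDelta * MvPowerSeries.X 1))) * invYZ

lemma constantCoeff_one_add (F : SZ) (i : Fin 2) :
    MvPowerSeries.constantCoeff (1 + F * MvPowerSeries.X i) = 1 := by simp

lemma constantCoeff_one_sub (F : SZ) (i : Fin 2) :
    MvPowerSeries.constantCoeff (1 - F * MvPowerSeries.X i) = 1 := by simp

/-- `ℤ⟨x, y⟩ → 𝔥`. -/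
noncomputable def toH : HZ →+* H := letterHom x y

/-- `ℤ⟨x, y⟩[[u, v]] → 𝔥[[u, v]]`. -/
noncomputable def toS : SZ →+* S := MvPowerSeries.map toH

lemma toS_C (a : HZ) : toS (MvPowerSeries.C a) = C (toH a) := MvPowerSeries.map_C _ _

lemma toS_X (i : Fin 2) : toS (MvPowerSeries.X i) = MvPowerSeries.X i := MvPowerSeries.map_X _ _

lemma toH_x : toH xZ = x := letterHom_x _ _

lemma toH_y : toH yZ = y := letterHom_y _ _

lemma constantCoeff_toS {F : SZ} (h : MvPowerSeries.constantCoeff F = 1) :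
    MvPowerSeries.constantCoeff (toS F) = 1 := by
  rw [toS, MvPowerSeries.constantCoeff_map, h, map_one]

lemma toS_invOne {F : SZ} (h : MvPowerSeries.constantCoeff F = 1) :
    toS (invOne F) = inv (toS F) := eq_invOne toS h (inv_mul_self (constantCoeff_toS h))

lemma toS_invYZ : toS invYZ = inv (1 + C y * u) := by
  rw [invYZ, toS_invOne (constantCoeff_one_add _ _), map_add, map_one, map_mul, toS_C, toS_X, toH_y]
  rfl

lemma Delta_C_x : Delta (C x) = toS xDelta := by
  rw [Delta_x, xDelta, map_mul, toS_invYZ, toS_C, toH_x]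

lemma Delta_C_y : Delta (C y) = toS yDelta := by
  have h : DeltaHom (C y) = DeltaHom (C (x + y)) - DeltaHom (C x) := by
    rw [← map_sub, map_add, add_sub_cancel_left]
  rw [yDelta, map_sub, toS_C, map_add toH, toH_x, toH_y, ← Delta_C_x, ← Delta_x_add_y]
  exact h

lemma Delta_C_toH (w : HZ) : Delta (C (toH w)) = toS (letterHom xDelta yDelta w) := by
  have h : (DeltaHom.comp (C.comp toH)) = toS.comp (letterHom xDelta yDelta) := by
    apply HZ_hom_ext
    · simp only [RingHom.comp_apply, letterHom_x, toH_x]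
      exact Delta_C_x
    · simp only [RingHom.comp_apply, letterHom_y, toH_y]
      exact Delta_C_y
  exact DFunLike.congr_fun h w

lemma Delta_inv {F : S} {G : SZ} (hF : MvPowerSeries.constantCoeff F = 1)
    (hG : MvPowerSeries.constantCoeff G = 1) (h : Delta F = toS G) :
    Delta (inv F) = toS (invOne G) :=
  eq_invOne DeltaHom hF (by
    rw [DeltaHom_apply, h, ← map_mul, invOne_mul hG, map_one])

/-- The correction factor `1 - yu/(1+xu) xv/(1-xv)`. -/
noncomputable def corr : S := 1 - C y * u * inv (1 + C x * u) * (C x * v * inv (1 - C x * v))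

lemma Delta_corr : Delta corr =
    toS (1 - yDelta * MvPowerSeries.X 0 * invOne (1 + xDelta * MvPowerSeries.X 0) *
      ((xDelta * MvPowerSeries.X 1) * invOne (1 - xDelta * MvPowerSeries.X 1))) := by
  have hx : DeltaHom (C x) = toS xDelta := Delta_C_x
  have hy : DeltaHom (C y) = toS yDelta := Delta_C_y
  have hu : DeltaHom u = toS (MvPowerSeries.X 0) := (Delta_X 0).trans (toS_X 0).symm
  have hv : DeltaHom v = toS (MvPowerSeries.X 1) := (Delta_X 1).trans (toS_X 1).symm
  have h1 : DeltaHom (inv (1 + C x * u)) = toS (invOne (1 + xDelta * MvPowerSeries.X 0)) := by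
    refine Delta_inv (by simp [u]) (constantCoeff_one_add _ _) ?_
    change DeltaHom _ = _
    simp only [map_add, map_one, map_mul, hx, hu]
  have h2 : DeltaHom (inv (1 - C x * v)) = toS (invOne (1 - xDelta * MvPowerSeries.X 1)) := by
    refine Delta_inv (by simp [v]) (constantCoeff_one_sub _ _) ?_
    change DeltaHom _ = _
    simp only [map_sub, map_one, map_mul, hx, hv]
  rw [← DeltaHom_apply, corr]
  simp only [map_sub, map_one, map_mul, hx, hy, hu, hv, h1, h2]

/-- Removing the final `x` from `Δ_u(x) = (1+yu)⁻¹x` leaves the last factor of `twisted`. -/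
lemma Delta_Rx (F : S) : Delta (Rx F) = Rx (Delta F * toS invYZ) := by
  rw [Rx, Delta_mul, Delta_C_x, xDelta, map_mul, toS_C, toH_x, Rx, mul_assoc]

lemma RxInv_Rx (F : S) : RxInv (Rx F) = F := Function.leftInverse_invFun Rx_injective F

lemma twisted_spec (w : HZ) : Delta (C (toH w) * corr) * toS invYZ = toS (twisted w) := by
  rw [Delta_mul, Delta_C_toH, Delta_corr, twisted, map_mul, map_mul]

/-- In this form `Δ_u(y)` visibly starts with `y`, which keeps all coefficients in `y𝔥`, where `Z`
is meaningful. -/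
lemma yDelta_eq : yDelta =
    MvPowerSeries.C yZ * (1 + MvPowerSeries.X 0 * invYZ * MvPowerSeries.C xZ) := by
  have h : (1 + MvPowerSeries.C yZ * MvPowerSeries.X 0) * invYZ = 1 :=
    mul_invOne (constantCoeff_one_add _ _)
  have h' : MvPowerSeries.C yZ * MvPowerSeries.X 0 * invYZ = 1 - invYZ := by
    rw [eq_sub_iff_add_eq', ← h, add_mul, one_mul]
  rw [mul_add, mul_one, ← mul_assoc, ← mul_assoc, h', yDelta, xDelta, map_add, sub_mul, one_mul]
  abel

lemma exists_twisted_y_mul (w : HZ) : ∃ F : SZ, twisted (yZ * w) = MvPowerSeries.C yZ * F := by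
  rw [twisted, map_mul, letterHom_y]
  conv => enter [1, F, 1, 1, 1, 1]; rw [yDelta_eq]
  simp only [mul_assoc]
  exact ⟨_, rfl⟩

/-! ### Nested sums along words -/

section NestedSum

variable {R : Type*} [CommRing R]

/-- The nested sum attached to a word: `x` divides by the current summation index, and `y` starts a
new sum over the indices in `(n, p)`. -/
def nestedSum (p : ℕ) (c : ℕ → R) : List Letter → ℕ → R
  | [], _ => 1
  | Letter.x :: l, n => c n * nestedSum p c l n
  | Letter.y :: l, n => ∑ j ∈ Finset.Ioo n p, c j * nestedSum p c l j

/-- The word with the given letters, in `ℤ⟨x, y⟩`. -/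
noncomputable def wordZ (l : List Letter) : HZ := (l.map (FreeAlgebra.ι ℤ)).prod

lemma wordZ_nil : wordZ [] = 1 := by simp [wordZ]

lemma wordZ_x (l : List Letter) : wordZ (Letter.x :: l) = xZ * wordZ l := by simp [wordZ, xZ]

lemma wordZ_y (l : List Letter) : wordZ (Letter.y :: l) = yZ * wordZ l := by simp [wordZ, yZ]

/-- The hockey-stick identity. -/
lemma sum_Ioo_choose (p k : ℕ) :
    ∑ j ∈ Finset.Ioo 0 p, (j - 1).choose k = (p - 1).choose (k + 1) := by
  rcases p with _ | q
  · simp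
  · have h : Finset.Ioo 0 (q + 1) = Finset.Ico (0 + 1) (q + 1) := by
      ext j
      simp only [Finset.mem_Ioo, Finset.mem_Ico]
      omega
    rw [h, ← Finset.sum_Ico_add' (fun j => (j - 1).choose k) 0 q 1, Nat.add_sub_cancel]
    simp only [Nat.add_sub_cancel]
    induction q with
    | zero => simp
    | succ q ih =>
      rw [Finset.sum_Ico_succ_top (Nat.zero_le q), ih (by ext; simp; omega), Nat.choose_succ_succ,
        add_comm]

lemma choose_pascal {j k : ℕ} (hj : 1 ≤ j) (hk : 1 ≤ k) :
    ((j - 1).choose (k - 1) : R) + ((j - 1).choose k : R) = (j.choose k : R) := by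
  obtain ⟨j, rfl⟩ : ∃ i, j = i + 1 := ⟨j - 1, by omega⟩
  obtain ⟨k, rfl⟩ : ∃ i, k = i + 1 := ⟨k - 1, by omega⟩
  rw [Nat.choose_succ_succ]
  push_cast
  rfl

variable {p : ℕ} {c : ℕ → R}

/-- The absorption identity for binomial coefficients, divided by `j k`. -/
lemma choose_mul_inv (hc : ∀ j, 1 ≤ j → j < p → (j : R) * c j = 1) {j k : ℕ} (hj : 1 ≤ j)
    (hjp : j < p) (hk : 1 ≤ k) (hkp : k < p) :
    (j.choose k : R) * c j = c k * ((j - 1).choose (k - 1) : R) := by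
  have h1 := hc j hj hjp
  have h2 := hc k hk hkp
  obtain ⟨j, rfl⟩ : ∃ i, j = i + 1 := ⟨j - 1, by omega⟩
  obtain ⟨k, rfl⟩ : ∃ i, k = i + 1 := ⟨k - 1, by omega⟩
  have h3 := congrArg (Nat.cast (R := R)) (Nat.add_one_mul_choose_eq j k)
  rw [Nat.add_sub_cancel, Nat.add_sub_cancel]
  push_cast at h1 h2 h3
  linear_combination (-((j + 1).choose (k + 1) : R) * c (j + 1)) * h2 +
    c (k + 1) * (j.choose k : R) * h1 - c (j + 1) * c (k + 1) * h3

/-- The sequence `b` is the binomial transform of the function `f` on `{1, …, p-1}`. -/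
def IsBinomTransform (p : ℕ) (f b : ℕ → R) : Prop :=
  b p = 0 ∧ ∀ k, 1 ≤ k → b k = ∑ j ∈ Finset.Ioo 0 p, ((j - 1).choose (k - 1) : R) * f j

lemma sum_choose_eq_zero {k : ℕ} (hk : p ≤ k + 1) (f : ℕ → R) :
    ∑ j ∈ Finset.Ioo 0 p, ((j - 1).choose k : R) * f j = 0 := by
  refine Finset.sum_eq_zero fun j hj => ?_
  rw [Finset.mem_Ioo] at hj
  rw [Nat.choose_eq_zero_of_lt (by omega), Nat.cast_zero, zero_mul]

/-- The binomial coefficient of `j - 1` over `k - 1` is the coefficient of `t^j` in `(t/(1-t))^k`,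
so `b_k` is the value there of the functional `t^j ↦ f j`. Pascal's rule and absorption give the
recursion of `X`. A binomial transform leaves entry `0` free; `c 0 = 0` makes it `-a_1`. -/
lemma xMat_mulVec_transform (hp : 1 ≤ p) (hc0 : c 0 = 0)
    (hc : ∀ j, 1 ≤ j → j < p → (j : R) * c j = 1) {f b : ℕ → R} (h : IsBinomTransform p f b) :
    ∃ a, (xMat p c).mulVec (vec p b) = vec p a ∧ IsBinomTransform p (fun j => c j * f j) a := by
  set g : ℕ → R := fun k => ∑ j ∈ Finset.Ioo 0 p, ((j - 1).choose (k - 1) : R) * (c j * f j) with hg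
  set a : ℕ → R := fun k => if k = 0 then -g 1 else g k with ha
  have hak : ∀ k, 1 ≤ k → a k = g k := fun k hk => if_neg (by omega)
  have hap : a p = 0 := (hak p hp).trans (sum_choose_eq_zero (by omega) _)
  refine ⟨a, xMat_mulVec hap fun k hk => ?_, hap, hak⟩
  rcases Nat.eq_zero_or_pos k with rfl | hk0
  · rw [hak 1 le_rfl, hc0]
    simp [ha]
  · rw [hak _ hk0, hak _ (by omega), h.2 k hk0, hg, ← Finset.sum_add_distrib, Finset.mul_sum]
    refine Finset.sum_congr rfl fun j hj => ?_
    rw [Finset.mem_Ioo] at hj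
    have h1 := choose_mul_inv hc hj.1 hj.2 hk0 hk
    have h2 := choose_pascal (R := R) hj.1 hk0
    rw [Nat.add_sub_cancel]
    linear_combination (c j * f j) * h2 + f j * h1

/-- The same argument with the index shifted by one. Now entry `0` is determined too: it is the full
sum of `c j * f j`, from which the harmonic sum is read off. -/
lemma yMat_mulVec_transform (hc : ∀ j, 1 ≤ j → j < p → (j : R) * c j = 1) {f b : ℕ → R}
    (h : IsBinomTransform p f b) : (yMat p c).mulVec (vec p b) =
      vec p fun k => ∑ j ∈ Finset.Ioo 0 p, ((j - 1).choose k : R) * (c j * f j) := by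
  refine yMat_mulVec (sum_choose_eq_zero (by omega) _) h.1 fun k hk => ?_
  rw [← Finset.sum_add_distrib]
  have hs : ∀ j ∈ Finset.Ioo 0 p, ((j - 1).choose k : R) * (c j * f j) +
      ((j - 1).choose (k + 1) : R) * (c j * f j) = (j.choose (k + 1) : R) * c j * f j := by
    intro j hj
    rw [Finset.mem_Ioo] at hj
    have h2 := choose_pascal (R := R) (k := k + 1) hj.1 (by omega)
    rw [Nat.add_sub_cancel] at h2
    linear_combination (c j * f j) * h2
  rw [Finset.sum_congr rfl hs]
  rcases Nat.lt_or_ge (k + 1) p with hk' | hk'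
  · rw [h.2 (k + 1) (by omega), Finset.mul_sum]
    refine Finset.sum_congr rfl fun j hj => ?_
    rw [Finset.mem_Ioo] at hj
    rw [choose_mul_inv hc hj.1 hj.2 (by omega) hk', mul_assoc]
  -- At `k + 1 = p` the inverse `c p` is not available, but both sides vanish.
  · rw [show k + 1 = p by omega, h.1, mul_zero]
    refine Finset.sum_eq_zero fun j hj => ?_
    rw [Finset.mem_Ioo] at hj
    rw [Nat.choose_eq_zero_of_lt hj.2, Nat.cast_zero, zero_mul, zero_mul]

/-- Exchanging the two sums leaves a hockey-stick sum over `n < j`. -/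
lemma isBinomTransform_y (f : ℕ → R) : IsBinomTransform p
    (fun n => ∑ j ∈ Finset.Ioo n p, c j * f j)
    fun k => ∑ j ∈ Finset.Ioo 0 p, ((j - 1).choose k : R) * (c j * f j) := by
  refine ⟨sum_choose_eq_zero (by omega) _, fun k hk => ?_⟩
  simp only [Finset.mul_sum]
  rw [Finset.sum_comm' (t' := Finset.Ioo 0 p) (s' := fun j => Finset.Ioo 0 j)
    (by simp only [Finset.mem_Ioo]; omega)]
  refine Finset.sum_congr rfl fun j _ => ?_
  rw [← Finset.sum_mul, ← Nat.cast_sum, sum_Ioo_choose, Nat.sub_add_cancel hk]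

/-- The binomial vector is the transform of the constant `1`, the nested sum of the empty word;
letters are then added on the left. -/
lemma wordZ_mulVec (hp : 1 ≤ p) (hc0 : c 0 = 0) (hc : ∀ j, 1 ≤ j → j < p → (j : R) * c j = 1)
    (l : List Letter) :
    ∃ b : ℕ → R, (letterHom (xMat p c) (yMat p c) (wordZ l)).mulVec (binomVec R p) = vec p b ∧
      IsBinomTransform p (nestedSum p c l) b := by
  induction l with
  | nil =>
    refine ⟨fun k => ((p - 1).choose k : R), ?_, ?_, ?_⟩
    · rw [wordZ_nil, map_one, Matrix.one_mulVec]
      rfl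
    · simp only
      rw [Nat.choose_eq_zero_of_lt (by omega), Nat.cast_zero]
    · intro k hk
      obtain ⟨k, rfl⟩ : ∃ i, k = i + 1 := ⟨k - 1, by omega⟩
      simp only [nestedSum, mul_one, Nat.add_sub_cancel]
      rw [← Nat.cast_sum, sum_Ioo_choose]
  | cons a l ih =>
    obtain ⟨b, hb, hbt⟩ := ih
    cases a with
    | x =>
      obtain ⟨a, ha, hat⟩ := xMat_mulVec_transform hp hc0 hc hbt
      exact ⟨a, by rw [wordZ_x, map_mul, letterHom_x, ← Matrix.mulVec_mulVec, hb, ha], hat⟩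
    | y =>
      refine ⟨_, ?_, isBinomTransform_y _⟩
      rw [wordZ_y, map_mul, letterHom_y, ← Matrix.mulVec_mulVec, hb, yMat_mulVec_transform hc hbt]

lemma wordZ_y_mulVec_zero (hp : 1 ≤ p) (hc0 : c 0 = 0)
    (hc : ∀ j, 1 ≤ j → j < p → (j : R) * c j = 1) (l : List Letter) :
    (letterHom (xMat p c) (yMat p c) (yZ * wordZ l)).mulVec (binomVec R p) ⟨0, hp⟩ =
      nestedSum p c (Letter.y :: l) 0 := by
  obtain ⟨b, hb, hbt⟩ := wordZ_mulVec hp hc0 hc l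
  rw [map_mul, letterHom_y, ← Matrix.mulVec_mulVec, hb, yMat_mulVec_transform hc hbt]
  simp [vec, nestedSum]

/-- The generating series of the nested sums of `1, y, y², …`. -/
def yPowSeries (p : ℕ) (c : ℕ → R) (n : ℕ) : MvPowerSeries (Fin 2) R := fun e =>
  if e 1 = 0 then nestedSum p c (List.replicate (e 0) Letter.y) n else 0

lemma coeff_yPowSeries (n : ℕ) (e : Fin 2 →₀ ℕ) : MvPowerSeries.coeff e (yPowSeries p c n) =
    if e 1 = 0 then nestedSum p c (List.replicate (e 0) Letter.y) n else 0 := rfl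

/-- The nested sum of `y^m` is an elementary symmetric polynomial in `c (n+1), …, c (p-1)`. The
induction on the number of factors splits off `j = n + 1`, according to whether the smallest index
equals it. -/
lemma yPowSeries_eq_prod {n k : ℕ} (h : n + k + 1 = p) : yPowSeries p c n =
    ∏ j ∈ Finset.Ico n (p - 1), (1 + MvPowerSeries.X 0 * MvPowerSeries.C (c (j + 1))) := by
  classical
  induction k generalizing n with
  | zero =>
    rw [show p - 1 = n by omega, Finset.Ico_self, Finset.prod_empty]
    ext e
    rw [coeff_yPowSeries, MvPowerSeries.coeff_one]
    have he : e = 0 ↔ e 1 = 0 ∧ e 0 = 0 := by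
      constructor
      · rintro rfl; simp
      · rintro ⟨h1, h0⟩
        ext i
        fin_cases i <;> simp [h1, h0]
    rcases h0 : e 0 with _ | m
    · simp [he, h0, nestedSum]
    · have : Finset.Ioo n p = ∅ := by
        ext j
        simp only [Finset.mem_Ioo, Finset.notMem_empty, iff_false]
        omega
      simp [he, h0, nestedSum, List.replicate_succ, this]
  | succ k ih =>
    rw [Finset.prod_eq_prod_Ico_succ_bot (by omega), ← ih (n := n + 1) (by omega)]
    ext e
    rw [add_mul, one_mul, map_add, mul_assoc, MvPowerSeries.X_def, MvPowerSeries.coeff_monomial_mul,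
      one_mul, coeff_yPowSeries, coeff_yPowSeries, MvPowerSeries.coeff_C_mul, coeff_yPowSeries]
    simp only [Finsupp.single_le_iff]
    have e1 : (e - Finsupp.single 0 1 : Fin 2 →₀ ℕ) 1 = e 1 := by simp
    have e0 : (e - Finsupp.single 0 1 : Fin 2 →₀ ℕ) 0 = e 0 - 1 := by simp
    rw [e1, e0]
    rcases h0 : e 0 with _ | m
    · simp [nestedSum]
    · rw [if_pos (Nat.le_add_left 1 m), Nat.add_sub_cancel, List.replicate_succ]
      rcases eq_or_ne (e 1) 0 with h1 | h1
      · have hi : Finset.Ioo n p = insert (n + 1) (Finset.Ioo (n + 1) p) := by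
          ext j
          simp only [Finset.mem_Ioo, Finset.mem_insert]
          omega
        simp only [nestedSum, if_pos h1]
        rw [hi, Finset.sum_insert (by simp), add_comm]
      · simp [h1]

lemma risingProd_eq_yPowSeries (hp : 1 ≤ p) :
    risingProd (fun j => MvPowerSeries.C (σ := Fin 2) (c j)) (MvPowerSeries.X 0) (p - 1) =
      yPowSeries p c 0 := by
  rw [yPowSeries_eq_prod (k := p - 1) (by omega), risingProd, Finset.range_eq_Ico]

end NestedSum

/-! ### Matrices of power series -/

section EvalMat

variable {R : Type*} [CommRing R] {M : Type*} [Ring M] {p : ℕ}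

/-- A power series with coefficients in `M`, evaluated at a representation of `M` by matrices. -/
noncomputable def evalMat (ρ : M →+* Matrix (Fin p) (Fin p) R) :
    MvPowerSeries (Fin 2) M →+* Matrix (Fin p) (Fin p) (MvPowerSeries (Fin 2) R) where
  toFun F := Matrix.of fun i j e => ρ (MvPowerSeries.coeff e F) i j
  map_one' := by
    classical
    ext i j e
    change ρ (MvPowerSeries.coeff e 1) i j = _
    rw [MvPowerSeries.coeff_one, Matrix.one_apply]
    by_cases he : e = 0
    · rw [if_pos he, map_one, Matrix.one_apply]
      split_ifs
      · rw [MvPowerSeries.coeff_one, if_pos he]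
      · rw [map_zero]
    · rw [if_neg he, map_zero]
      split_ifs
      · rw [MvPowerSeries.coeff_one, if_neg he]; rfl
      · rw [map_zero]; rfl
  map_mul' F G := by
    ext i j e
    change ρ (MvPowerSeries.coeff e (F * G)) i j = _
    rw [MvPowerSeries.coeff_mul, map_sum, Matrix.sum_apply, Matrix.mul_apply, map_sum]
    simp only [map_mul, Matrix.mul_apply, MvPowerSeries.coeff_mul]
    rw [Finset.sum_comm]
    rfl
  map_zero' := by
    ext i j e
    change ρ (MvPowerSeries.coeff e 0) i j = _
    rw [map_zero, map_zero]
    rfl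
  map_add' F G := by
    ext i j e
    change ρ (MvPowerSeries.coeff e (F + G)) i j = _
    rw [map_add, map_add]
    rfl

variable (ρ : M →+* Matrix (Fin p) (Fin p) R)

lemma coeff_evalMat (F : MvPowerSeries (Fin 2) M) (i j : Fin p) (e : Fin 2 →₀ ℕ) :
    MvPowerSeries.coeff e (evalMat ρ F i j) = ρ (MvPowerSeries.coeff e F) i j := rfl

lemma evalMat_C (a : M) :
    evalMat ρ (MvPowerSeries.C a) = MvPowerSeries.C.mapMatrix (ρ a) := by
  classical
  ext i j e
  rw [coeff_evalMat, RingHom.mapMatrix_apply, Matrix.map_apply, MvPowerSeries.coeff_C,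
    MvPowerSeries.coeff_C]
  split_ifs <;> simp

lemma evalMat_X (k : Fin 2) :
    evalMat ρ (MvPowerSeries.X k) = (MvPowerSeries.X k : MvPowerSeries (Fin 2) R) • 1 := by
  classical
  ext i j e
  rw [coeff_evalMat, Matrix.smul_apply, MvPowerSeries.coeff_X, Matrix.one_apply]
  split_ifs with h1 h2 h2
  · rw [map_one, h2, Matrix.one_apply_eq, smul_eq_mul, mul_one, MvPowerSeries.coeff_X, if_pos h1]
  · rw [map_one, Matrix.one_apply_ne h2, smul_zero, map_zero]
  · rw [map_zero, smul_eq_mul, mul_one, MvPowerSeries.coeff_X, if_neg h1]; rfl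
  · rw [map_zero, smul_zero, map_zero]; rfl

lemma evalMat_mul_X (F : MvPowerSeries (Fin 2) M) (k : Fin 2) :
    evalMat ρ (F * MvPowerSeries.X k) =
      (MvPowerSeries.X k : MvPowerSeries (Fin 2) R) • evalMat ρ F := by
  rw [map_mul, evalMat_X, mul_smul_comm, mul_one]

lemma coeff_evalMat_mulVec (F : MvPowerSeries (Fin 2) M) (b : Fin p → R) (i : Fin p)
    (e : Fin 2 →₀ ℕ) :
    MvPowerSeries.coeff e ((evalMat ρ F).mulVec (fun j => MvPowerSeries.C (b j)) i) =
      (ρ (MvPowerSeries.coeff e F)).mulVec b i := by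
  simp only [Matrix.mulVec, dotProduct, map_sum, MvPowerSeries.coeff_mul_C, coeff_evalMat]

end EvalMat

/-! ### The congruence modulo `p ^ N` -/

section Congruence

variable {R : Type*} [CommRing R] {p : ℕ} {c : ℕ → R}

lemma mapMatrix_altMat {L : Type*} [CommRing L] (f : R →+* L) :
    f.mapMatrix (altMat R p) = altMat L p := by
  ext i j
  simp [altMat, apply_ite f]

lemma mapMatrix_shiftMat {L : Type*} [CommRing L] (f : R →+* L) :
    f.mapMatrix (shiftMat R p) = shiftMat L p := by
  ext i j
  simp [shiftMat, apply_ite f]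

lemma mapMatrix_diagMat {L : Type*} [CommRing L] (f : R →+* L) (b : ℕ → R) :
    f.mapMatrix (diagMat p b) = diagMat p fun j => f (b j) := by
  simp [diagMat, Matrix.diagonal_map]

lemma mapMatrix_xMat {L : Type*} [CommRing L] (f : R →+* L) :
    f.mapMatrix (xMat p c) = xMat p fun j => f (c j) := by
  rw [xMat, map_mul, mapMatrix_altMat, mapMatrix_diagMat, xMat]

lemma mapMatrix_yMat {L : Type*} [CommRing L] (f : R →+* L) :
    f.mapMatrix (yMat p c) = yMat p fun j => f (c j) := by
  rw [yMat, map_mul, map_mul, mapMatrix_altMat, mapMatrix_diagMat, mapMatrix_shiftMat, yMat]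

/-- The exponent of `u^m v^n`. -/
noncomputable def expo (m n : ℕ) : Fin 2 →₀ ℕ := Finsupp.single 0 m + Finsupp.single 1 n

@[simp] lemma expo_zero (m n : ℕ) : expo m n 0 = m := by simp [expo]

@[simp] lemma expo_one (m n : ℕ) : expo m n 1 = n := by simp [expo]

/-- Setting `v = p` modulo `p^N` kills the multiples of `p - v`. -/
lemma dvd_sum_coeff_mul_sub (J : MvPowerSeries (Fin 2) R) (a : R) (m N : ℕ) :
    a ^ N ∣ ∑ n ∈ Finset.range N,
      MvPowerSeries.coeff (expo m n) ((MvPowerSeries.C a - MvPowerSeries.X 1) * J) * a ^ n := by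
  have hc : ∀ n, MvPowerSeries.coeff (expo m n) ((MvPowerSeries.C a - MvPowerSeries.X 1) * J) =
      a * MvPowerSeries.coeff (expo m n) J -
        if 1 ≤ n then MvPowerSeries.coeff (expo m (n - 1)) J else 0 := by
    intro n
    rw [sub_mul, map_sub, MvPowerSeries.coeff_C_mul, MvPowerSeries.X_def,
      MvPowerSeries.coeff_monomial_mul, one_mul]
    simp only [Finsupp.single_le_iff, expo_one]
    congr 1
    refine if_congr Iff.rfl (congrArg (fun d => MvPowerSeries.coeff d J) ?_) rfl
    ext i
    fin_cases i <;> simp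
  rcases N with _ | N
  · simp
  · have hs : ∀ N, ∑ n ∈ Finset.range (N + 1),
        MvPowerSeries.coeff (expo m n) ((MvPowerSeries.C a - MvPowerSeries.X 1) * J) * a ^ n =
        a ^ (N + 1) * MvPowerSeries.coeff (expo m N) J := by
      intro N
      induction N with
      | zero => simp [hc]
      | succ N ih =>
        rw [Finset.sum_range_succ, ih, hc, if_pos (by omega), Nat.add_sub_cancel]
        ring
    exact ⟨_, hs N⟩

/-- The theorem modulo `p^N`, over a ring in which `1, …, p-1` are invertible. -/
lemma dvd_sum_twisted (hp : 1 ≤ p) (hc0 : c 0 = 0)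
    (hc : ∀ j, 1 ≤ j → j < p → (j : R) * c j = 1) (w : HZ) (m N : ℕ) :
    (p : R) ^ N ∣ ∑ n ∈ Finset.range N,
      (letterHom (xMat p c) (yMat p c) (MvPowerSeries.coeff (expo m n) (twisted w))).mulVec
        (binomVec R p) ⟨0, hp⟩ * (p : R) ^ n -
      (if N = 0 then 0 else
        (letterHom (xMat p c) (yMat p c) w).mulVec (binomVec R p) ⟨0, hp⟩ *
          nestedSum p c (List.replicate m Letter.y) 0) := by
  set K := MvPowerSeries (Fin 2) R with hK
  set C' : R →+* K := MvPowerSeries.C with hC'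
  set ρ := letterHom (xMat p c) (yMat p c) with hρ
  set Ψ := evalMat ρ with hΨ
  have hx : Ψ (MvPowerSeries.C xZ) = xMat p fun j => C' (c j) := by
    rw [hΨ, evalMat_C, hρ, letterHom_x, mapMatrix_xMat]
  have hy : Ψ (MvPowerSeries.C yZ) = yMat p fun j => C' (c j) := by
    rw [hΨ, evalMat_C, hρ, letterHom_y, mapMatrix_yMat]
  have hone : ∀ F k, Ψ (1 + F * MvPowerSeries.X k) = 1 + (MvPowerSeries.X k : K) • Ψ F := by
    intro F k
    rw [map_add, map_one, hΨ, evalMat_mul_X]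
  have hone' : ∀ F k, Ψ (1 - F * MvPowerSeries.X k) = 1 - (MvPowerSeries.X k : K) • Ψ F := by
    intro F k
    rw [map_sub, map_one, hΨ, evalMat_mul_X]
  have hA : (1 + (MvPowerSeries.X 0 : K) • yMat p fun j => C' (c j)) * Ψ invYZ = 1 := by
    rw [← hy, ← hone, ← map_mul, invYZ, mul_invOne (constantCoeff_one_add _ _), map_one]
  have hxD : Ψ xDelta = Ψ invYZ * xMat p fun j => C' (c j) := by rw [xDelta, map_mul, hx]
  have hyD : Ψ yDelta = (xMat p fun j => C' (c j)) + (yMat p fun j => C' (c j)) -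
      Ψ invYZ * xMat p fun j => C' (c j) := by
    rw [yDelta, map_sub, map_add, map_add, hx, hy, hxD]
  have hW' : (Ψ.comp (letterHom xDelta yDelta)) = letterHom (Ψ xDelta) (Ψ yDelta) :=
    HZ_hom_ext (by simp only [RingHom.comp_apply, letterHom_x])
      (by simp only [RingHom.comp_apply, letterHom_y])
  have hW : (C'.mapMatrix.comp ρ) =
      letterHom (xMat p fun j => C' (c j)) (yMat p fun j => C' (c j)) :=
    HZ_hom_ext (by simp only [RingHom.comp_apply, hρ, letterHom_x, mapMatrix_xMat])
      (by simp only [RingHom.comp_apply, hρ, letterHom_y, mapMatrix_yMat])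
  have hDW : diagMat p (risingProd (fun j => C' (c j)) (MvPowerSeries.X 0)) *
      Ψ (letterHom xDelta yDelta w) = C'.mapMatrix (ρ w) *
        diagMat p (risingProd (fun j => C' (c j)) (MvPowerSeries.X 0)) := by
    have h1 := DFunLike.congr_fun hW' w
    have h2 := DFunLike.congr_fun hW w
    rw [RingHom.comp_apply] at h1 h2
    rw [h1, h2, hxD, hyD]
    exact intertwine_letterHom (risingProd_mul_xMat hA) (risingProd_mul_yMat hA) w
  -- The parameters of the matrix identity are `s = u` and `r = v`, over the ring of power series in
  -- `u` and `v`.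
  obtain ⟨J, hJ⟩ := exists_twist (K := K) hp (by rw [hc0, map_zero])
    (fun j h1 h2 => by rw [← map_natCast C', ← map_mul, hc j h1 h2, map_one]) hA
    (B := Ψ (invOne (1 + MvPowerSeries.C xZ * MvPowerSeries.X 0)))
    (E := Ψ (invOne (1 - MvPowerSeries.C xZ * MvPowerSeries.X 1)))
    (B' := Ψ (invOne (1 + xDelta * MvPowerSeries.X 0)))
    (E' := Ψ (invOne (1 - xDelta * MvPowerSeries.X 1))) (r := MvPowerSeries.X 1)
    (by rw [← hx, ← hone, ← map_mul, invOne_mul (constantCoeff_one_add _ _), map_one])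
    (by rw [← hx, ← hone', ← map_mul, invOne_mul (constantCoeff_one_sub _ _), map_one])
    (by rw [← hxD, ← hone, ← map_mul, mul_invOne (constantCoeff_one_add _ _), map_one])
    (by rw [← hxD, ← hone', ← map_mul, mul_invOne (constantCoeff_one_sub _ _), map_one]) hDW
  have hlam : binomVec K p = fun j => C' (binomVec R p j) := by
    funext j
    simp [binomVec, vec]
  have htw : Ψ (twisted w) = Ψ (letterHom xDelta yDelta w) *
      (1 - ((MvPowerSeries.X 0 : K) • ((xMat p fun j => C' (c j)) + (yMat p fun j => C' (c j)) -
          Ψ invYZ * xMat p fun j => C' (c j))) * Ψ (invOne (1 + xDelta * MvPowerSeries.X 0)) *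
        (((MvPowerSeries.X 1 : K) • (Ψ invYZ * xMat p fun j => C' (c j))) *
          Ψ (invOne (1 - xDelta * MvPowerSeries.X 1)))) * Ψ invYZ := by
    rw [← hyD, ← hxD]
    simp only [twisted, map_mul, map_sub, map_one]
    rw [← map_mul Ψ yDelta, ← map_mul Ψ xDelta, hΨ, evalMat_mul_X, evalMat_mul_X]
  rw [← htw] at hJ
  -- In entry `0` the diagonal matrix acts as `1`, so the twist disappears.
  have h0 := congrFun hJ ⟨0, hp⟩
  rw [diagMat, Matrix.mulVec_diagonal, risingProd_zero, one_mul, Matrix.mulVec_add,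
    Matrix.mulVec_smul, Matrix.mulVec_smul, Pi.add_apply, Pi.smul_apply, Pi.smul_apply,
    risingProd_eq_yPowSeries hp, hlam, smul_eq_mul, smul_eq_mul, ← map_natCast C'] at h0
  have hcoe : ∀ n, (ρ (MvPowerSeries.coeff (expo m n) (twisted w))).mulVec
      (binomVec R p) ⟨0, hp⟩ =
      (if n = 0 then (ρ w).mulVec (binomVec R p) ⟨0, hp⟩ *
        nestedSum p c (List.replicate m Letter.y) 0 else 0) +
      MvPowerSeries.coeff (expo m n) ((MvPowerSeries.C (p : R) - MvPowerSeries.X 1) *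
        (C'.mapMatrix (ρ w)).mulVec J ⟨0, hp⟩) := by
    intro n
    rw [← coeff_evalMat_mulVec, ← hΨ, ← hC', h0, map_add]
    congr 1
    have hw : (C'.mapMatrix (ρ w)).mulVec (fun j => C' (binomVec R p j)) ⟨0, hp⟩ =
        C' ((ρ w).mulVec (binomVec R p) ⟨0, hp⟩) := by
      simp [Matrix.mulVec, dotProduct]
    rw [hw, hC', MvPowerSeries.coeff_mul_C, coeff_yPowSeries, expo_one, expo_zero, ite_mul,
      zero_mul, mul_comm]
  simp only [hcoe, add_mul, Finset.sum_add_distrib]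
  rcases N with _ | N
  · simp
  · rw [if_neg (by omega), Finset.sum_range_succ']
    simp only [Nat.add_eq_zero_iff, one_ne_zero, and_false, if_false, zero_mul,
      Finset.sum_const_zero, if_true, pow_zero, mul_one, zero_add, add_sub_cancel_left]
    exact dvd_sum_coeff_mul_sub _ _ _ _

end Congruence

/-! ### Multiple harmonic sums -/

section StrictSum

variable {R : Type*} [CommRing R]

/-- The sum of `∏ c(n_i)^{k_i}` over `n < n_1 < ⋯ < n_r < p`. -/
def strictSum (p : ℕ) (c : ℕ → R) (n : ℕ) (k : List ℕ) : R :=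
  ∑ f ∈ (Fintype.piFinset fun _ : Fin k.length => Finset.Ioo n p).filter
    (fun f => ∀ i j, i < j → f i < f j), ∏ i, c (f i) ^ k.get i

lemma strictSum_nil (p : ℕ) (c : ℕ → R) (n : ℕ) : strictSum p c n [] = 1 := by
  rw [strictSum, Finset.filter_true_of_mem (fun f _ i => i.elim0)]
  simp

lemma strictSum_cons (p : ℕ) (c : ℕ → R) (n a : ℕ) (k : List ℕ) :
    strictSum p c n (a :: k) = ∑ j ∈ Finset.Ioo n p, c j ^ a * strictSum p c j k := by
  simp only [strictSum, Finset.mul_sum]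
  rw [Finset.sum_sigma']
  refine Finset.sum_bij' (fun (f : Fin (k.length + 1) → ℕ) _ =>
      (⟨f 0, fun i => f i.succ⟩ : (_ : ℕ) × (Fin k.length → ℕ)))
    (fun s _ => (Fin.cons s.1 s.2 : Fin (k.length + 1) → ℕ)) ?_ ?_ ?_ ?_ ?_
  · intro f hf
    simp only [Finset.mem_filter, Fintype.mem_piFinset, Finset.mem_sigma, Finset.mem_Ioo] at hf ⊢
    exact ⟨hf.1 (0 : Fin (k.length + 1)), fun i => ⟨hf.2 _ _ i.succ_pos, (hf.1 i.succ).2⟩,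
      fun i j hij => hf.2 _ _ (Fin.succ_lt_succ_iff.2 hij)⟩
  · rintro ⟨j, f⟩ hf
    simp only [Finset.mem_filter, Fintype.mem_piFinset, Finset.mem_sigma, Finset.mem_Ioo] at hf ⊢
    refine ⟨fun i => ?_, fun i i' => ?_⟩
    · refine Fin.cases ?_ (fun i => ?_) i
      · exact hf.1
      · exact ⟨hf.1.1.trans (hf.2.1 i).1, (hf.2.1 i).2⟩
    · refine Fin.cases ?_ (fun i => ?_) i <;> refine Fin.cases ?_ (fun i' => ?_) i'
      · exact fun h => absurd h (lt_irrefl _)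
      · exact fun _ => (hf.2.1 i').1
      · exact fun h => absurd h (Fin.not_lt_zero _)
      · exact fun h => hf.2.2 i i' (Fin.succ_lt_succ_iff.1 h)
  · intro f _
    funext i
    refine Fin.cases ?_ (fun i => ?_) i <;> rfl
  · rintro ⟨j, f⟩ _
    rfl
  · intro f _
    exact Fin.prod_univ_succ (n := k.length) _

lemma nestedSum_eq (p : ℕ) (c : ℕ → R) (l : List Letter) (n : ℕ) :
    nestedSum p c l n = c n ^ (parse l).1 * strictSum p c n (parse l).2 := by
  induction l generalizing n with
  | nil => simp [nestedSum, parse, strictSum_nil]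
  | cons a l ih =>
    cases a with
    | x => rw [nestedSum, ih, parse, pow_succ', mul_assoc]
    | y =>
      rw [nestedSum, parse, pow_zero, one_mul, strictSum_cons]
      refine Finset.sum_congr rfl fun j _ => ?_
      rw [ih, pow_succ', mul_assoc]

end StrictSum

/-- The inverses of the integers in `ℤ_p`. -/
noncomputable def padicInv (p : Nat.Primes) (j : ℕ) : ℤ_[(p : ℕ)] := Ring.inverse (j : ℤ_[(p : ℕ)])

lemma padicInv_zero (p : Nat.Primes) : padicInv p 0 = 0 := by simp [padicInv]

lemma mul_padicInv (p : Nat.Primes) (j : ℕ) (h1 : 1 ≤ j) (hj : j < p) :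
    (j : ℤ_[(p : ℕ)]) * padicInv p j = 1 := by
  refine Ring.mul_inverse_cancel _ ?_
  rw [PadicInt.isUnit_iff]
  refine le_antisymm (PadicInt.norm_le_one _) (not_lt.mp fun hlt => ?_)
  have h := (PadicInt.norm_int_lt_one_iff_dvd (p := (p : ℕ)) (j : ℤ)).mp (by exact_mod_cast hlt)
  have := Nat.le_of_dvd h1 (Int.natCast_dvd_natCast.mp h)
  omega

lemma harmonicSum_eq (p : Nat.Primes) (k : List ℕ) :
    harmonicSum p k = strictSum p (padicInv p) 0 k := by
  have h : Finset.Icc 1 ((p : ℕ) - 1) = Finset.Ioo 0 (p : ℕ) := by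
    have := p.2.pos
    ext j
    simp only [Finset.mem_Icc, Finset.mem_Ioo]
    omega
  rw [harmonicSum, strictSum, h]
  refine Finset.sum_congr rfl fun f _ => Finset.prod_congr rfl fun i _ => ?_
  rw [padicInv, Ring.inverse_pow]

lemma zetaAhat_parse (l : List Letter) (hl : (parse l).1 = 0) :
    zetaAhat (parse l).2 = toAhat fun p => nestedSum p (padicInv p) l 0 := by
  rw [zetaAhat]
  congr 1
  funext p
  rw [nestedSum_eq, hl, pow_zero, one_mul, harmonicSum_eq]

/-- The representation of `ℤ⟨x, y⟩` by matrices over `ℤ_p`. -/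
noncomputable def padicRep (p : Nat.Primes) :
    HZ →+* Matrix (Fin (p : ℕ)) (Fin (p : ℕ)) ℤ_[(p : ℕ)] :=
  letterHom (xMat p (padicInv p)) (yMat p (padicInv p))

/-- The value of an element of `ℤ⟨x, y⟩` at the prime `p`. -/
noncomputable def padicValue (p : Nat.Primes) (b : HZ) : ℤ_[(p : ℕ)] :=
  (padicRep p b).mulVec (binomVec ℤ_[(p : ℕ)] p) ⟨0, p.2.one_le⟩

lemma padicValue_add (p : Nat.Primes) (a b : HZ) :
    padicValue p (a + b) = padicValue p a + padicValue p b := by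
  simp [padicValue, Matrix.add_mulVec]

lemma padicValue_y_mul_wordZ (p : Nat.Primes) (l : List Letter) :
    padicValue p (yZ * wordZ l) = nestedSum p (padicInv p) (Letter.y :: l) 0 :=
  wordZ_y_mulVec_zero p.2.one_le (padicInv_zero p) (mul_padicInv p) l

lemma toH_wordZ (l : List Letter) : toH (wordZ l) = (l.map (FreeAlgebra.ι ℚ)).prod := by
  induction l with
  | nil => simp [wordZ_nil]
  | cons a l ih =>
    cases a with
    | x => rw [wordZ_x, map_mul, ih, toH_x]; simp [x]
    | y => rw [wordZ_y, map_mul, ih, toH_y]; simp [y]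

lemma basisZ_apply (w : List Letter) :
    FreeAlgebra.basisFreeMonoid ℤ Letter (FreeMonoid.ofList w) = wordZ w := by
  simp [FreeAlgebra.basisFreeMonoid, FreeAlgebra.equivMonoidAlgebraFreeMonoid,
    MonoidAlgebra.lift_single, FreeMonoid.lift_apply, wordZ]
  exact one_smul _ _

lemma Z_basis (l : List Letter) (hl : (parse l).1 = 0) :
    Z (l.map (FreeAlgebra.ι ℚ)).prod = toAhat fun p => nestedSum p (padicInv p) l 0 := by
  rw [← basis_apply, Z, Module.Basis.constr_basis, FreeMonoid.toList_ofList, if_pos hl,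
    zetaAhat_parse l hl]

/-- Both sides are additive in `b`, so it suffices to compare them on words. The factor `yZ` is
needed because entry `0` is a harmonic sum only for words starting with `y`. -/
lemma Z_toH (b : HZ) : Z (toH (yZ * b)) = toAhat fun p => padicValue p (yZ * b) := by
  let f : HZ →ₗ[ℤ] Ahat := (AddMonoidHom.mk' (fun b => Z (toH (yZ * b)))
    fun a b => by rw [mul_add, map_add, map_add]).toIntLinearMap
  let g : HZ →ₗ[ℤ] Ahat := (AddMonoidHom.mk' (fun b => toAhat fun p => padicValue p (yZ * b))
    fun a b => by
      rw [← map_add]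
      congr 1
      funext p
      rw [mul_add, padicValue_add]
      rfl).toIntLinearMap
  have h : f = g := by
    refine (FreeAlgebra.basisFreeMonoid ℤ Letter).ext fun l => ?_
    have hl := basisZ_apply (FreeMonoid.toList l)
    rw [FreeMonoid.ofList_toList] at hl
    rw [hl]
    change Z (toH (yZ * wordZ _)) = toAhat fun p => padicValue p (yZ * wordZ _)
    simp only [padicValue_y_mul_wordZ]
    rw [← wordZ_y, toH_wordZ, Z_basis _ rfl]
  exact DFunLike.congr_fun h b

lemma coeff_inv_one_sub_y (m : ℕ) : β m 0 (inv (1 - C y * u)) = y ^ m := by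
  classical
  set G : S := fun e => if e 1 = 0 then y ^ e 0 else 0 with hG
  have hGe : ∀ e, MvPowerSeries.coeff e G = if e 1 = 0 then y ^ e 0 else 0 := fun e => rfl
  have h : (1 - C y * u) * G = 1 := by
    ext e
    have e1 : (e - Finsupp.single 0 1 : Fin 2 →₀ ℕ) 1 = e 1 := by simp
    have e0 : (e - Finsupp.single 0 1 : Fin 2 →₀ ℕ) 0 = e 0 - 1 := by simp
    have he : e = 0 ↔ e 1 = 0 ∧ e 0 = 0 := by
      constructor
      · rintro rfl; simp
      · rintro ⟨h1, h0⟩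
        ext i
        fin_cases i <;> simp [h1, h0]
    rw [sub_mul, one_mul, mul_assoc, map_sub, coeff_C_mul', coeff_u_mul, hGe, hGe, e1, e0,
      MvPowerSeries.coeff_one]
    simp only [he]
    rcases h0 : e 0 with _ | k
    · simp
    · rcases eq_or_ne (e 1) 0 with h1 | h1
      · simp [h1, pow_succ']
      · simp [h1]
  have hinv : inv (1 - C y * u) = G := by
    calc inv (1 - C y * u) = inv (1 - C y * u) * ((1 - C y * u) * G) := by rw [h, mul_one]
      _ = G := by rw [← mul_assoc, inv_mul_self (by simp [u]), one_mul]
  rw [hinv]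
  change MvPowerSeries.coeff (expo m 0) G = _
  rw [hGe, expo_one, expo_zero, if_pos rfl]

lemma Z_y_pow (m : ℕ) : Z (y ^ m) =
    toAhat fun p => nestedSum p (padicInv p) (List.replicate m Letter.y) 0 := by
  have h : (parse (List.replicate m Letter.y)).1 = 0 := by
    cases m <;> simp [parse, List.replicate_succ]
  rw [← Z_basis _ h]
  simp [y]

/-! ### Convergence -/

/-- The projection `Â → 𝒜_N`. -/
noncomputable def toA (N : ℕ) : Ahat →+* A N :=
  (Pi.evalRingHom (fun n => A n) N).comp AhatSubring.subtype

lemma toA_toAhat_eq_zero {N : ℕ} {a : ∀ p : Nat.Primes, ℤ_[(p : ℕ)]}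
    (h : ∀ p : Nat.Primes, ((p : ℕ) : ℤ_[(p : ℕ)]) ^ N ∣ a p) : toA N (toAhat a) = 0 := by
  change A.mk N _ = 0
  rw [← map_zero (A.mk N)]
  congr 1
  funext p
  change PadicInt.toZModPow N (a p) = 0
  obtain ⟨b, hb⟩ := h p
  rw [hb, map_mul, map_pow, map_natCast, ← Nat.cast_pow, ZMod.natCast_self, zero_mul]

lemma toA_bp_pow {N n : ℕ} (h : N ≤ n) : toA N (bp ^ n) = 0 := by
  rw [bp, ← map_pow]
  exact toA_toAhat_eq_zero fun p => pow_dvd_pow _ h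

/-- Convergence is tested in each discrete ring `𝒜_N`, where `𝐩^n = 0` for `n ≥ N` and the series is
a finite sum. -/
lemma hasSum_Ahat {f : ℕ → Ahat} {a : Ahat}
    (h : ∀ N, toA N (∑ n ∈ Finset.range N, f n * bp ^ n - a) = 0) :
    HasSum (fun n => f n * bp ^ n) a := by
  refine (Topology.IsInducing.subtypeVal.hasSum_iff (g := AhatSubring.subtype) _ _).1 ?_
  refine Pi.hasSum.2 fun N => ?_
  have hN := h N
  rw [map_sub, sub_eq_zero, map_sum] at hN
  change HasSum (fun n => toA N (f n * bp ^ n)) (toA N a)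
  rw [← hN]
  refine hasSum_sum_of_ne_finset_zero fun n hn => ?_
  rw [Finset.mem_range, not_lt] at hn
  rw [map_mul, toA_bp_pow hn, mul_zero]

/-- `R_x⁻¹ Δ_u R_x` of the series attached to `y h`. -/
noncomputable def twistY (h : H) : S := Delta (C (y * h) * corr) * toS invYZ

lemma twistY_add (a b : H) : twistY (a + b) = twistY a + twistY b := by
  simp only [twistY, ← DeltaHom_apply, mul_add, map_add, add_mul]

lemma deriv_algebraMap (l : ℕ) (q : ℚ) : deriv l (algebraMap ℚ H q) = 0 := by
  rw [Algebra.algebraMap_eq_smul_one, map_smul, deriv_one, smul_zero]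

lemma Delta_C_algebraMap (q : ℚ) : Delta (C (algebraMap ℚ H q)) = C (algebraMap ℚ H q) := by
  classical
  refine Delta_eq_self fun l e => ?_
  rw [C, MvPowerSeries.coeff_C]
  split_ifs
  · exact deriv_algebraMap l q
  · exact map_zero _

/-- Rational constants are killed by every `deriv l`, so `Δ_u` fixes them. -/
lemma beta_twistY_smul (q : ℚ) (a : H) (m n : ℕ) :
    β m n (twistY (q • a)) = q • β m n (twistY a) := by
  have h : twistY (q • a) = C (algebraMap ℚ H q) * twistY a := by
    rw [twistY, mul_smul_comm, Algebra.smul_def, map_mul, mul_assoc, Delta_mul,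
      Delta_C_algebraMap, mul_assoc]
    rfl
  rw [h, Algebra.smul_def]
  exact coeff_C_mul' _ _ _

lemma beta_twistY_mem (h : H) (m n : ℕ) : β m n (twistY h) ∈ yH := by
  have hy : twistY h = C y * (toS (1 + MvPowerSeries.X 0 * invYZ * MvPowerSeries.C xZ) *
      Delta (C h) * Delta corr * toS invYZ) := by
    rw [twistY, Delta_mul, map_mul, Delta_mul, Delta_C_y, yDelta_eq, map_mul, toS_C, toH_y]
    simp only [mul_assoc]
  rw [hy]
  exact ⟨_, (coeff_C_mul' _ _ _).symm⟩

lemma beta_twistY_toH (b : HZ) (m n : ℕ) : Z (β m n (twistY (toH b))) =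
    toAhat fun p => padicValue p (MvPowerSeries.coeff (expo m n) (twisted (yZ * b))) := by
  have h : twistY (toH b) = toS (twisted (yZ * b)) := by
    rw [← twisted_spec, map_mul, toH_y, twistY]
  obtain ⟨F, hF⟩ := exists_twisted_y_mul b
  have hc : MvPowerSeries.coeff (expo m n) (twisted (yZ * b)) =
      yZ * MvPowerSeries.coeff (expo m n) F := by rw [hF, MvPowerSeries.coeff_C_mul]
  rw [hc, ← Z_toH, ← hc, h]
  rfl

/-- Both sides are `ℚ`-linear in `h`, so words suffice. Words are integral, and divisibility by
`p^N` at every prime means vanishing in `𝒜_N`. -/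
lemma toA_sum_twistY (m N : ℕ) (h : H) :
    toA N (∑ n ∈ Finset.range N, Z (β m n (twistY h)) * bp ^ n -
      Z (y * h) * Z (β m 0 (inv (1 - C y * u)))) = 0 := by
  have hspan := (FreeAlgebra.basisFreeMonoid ℚ Letter).mem_span h
  induction hspan using Submodule.span_induction with
  | mem h hh =>
    obtain ⟨l, rfl⟩ := hh
    have hl := basis_apply (FreeMonoid.toList l)
    rw [FreeMonoid.ofList_toList, ← toH_wordZ] at hl
    rw [hl]
    set b := wordZ (FreeMonoid.toList l)
    have hyb : Z (y * toH b) = toAhat fun p => padicValue p (yZ * b) := by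
      rw [← Z_toH, map_mul toH, toH_y]
    simp only [beta_twistY_toH]
    rw [hyb, coeff_inv_one_sub_y, Z_y_pow, bp]
    simp only [← map_pow, ← map_mul]
    rw [← map_sum, ← map_sub]
    refine toA_toAhat_eq_zero fun p => ?_
    rcases Nat.eq_zero_or_pos N with rfl | hN
    · simp
    · have h := dvd_sum_twisted p.2.one_le (padicInv_zero p) (mul_padicInv p) (yZ * b) m N
      rw [if_neg (by omega)] at h
      simp only [Pi.sub_apply, Finset.sum_apply, Pi.mul_apply, Pi.pow_apply]
      exact h
  | zero =>
    have h0 : ∀ n, β m n (twistY 0) = 0 := fun n => by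
      have := beta_twistY_smul 0 0 m n
      rwa [zero_smul, zero_smul] at this
    simp [h0]
  | add a b _ _ ha hb =>
    rw [map_sub, sub_eq_zero] at ha hb ⊢
    simp only [twistY_add, mul_add, map_add, add_mul, Finset.sum_add_distrib, ha, hb]
  | smul q a _ ha =>
    have h : ∑ n ∈ Finset.range N, Z (β m n (twistY (q • a))) * bp ^ n -
        Z (y * q • a) * Z (β m 0 (inv (1 - C y * u))) = algebraMap ℚ Ahat q *
        (∑ n ∈ Finset.range N, Z (β m n (twistY a)) * bp ^ n -
          Z (y * a) * Z (β m 0 (inv (1 - C y * u)))) := by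
      rw [← Algebra.smul_def]
      simp only [beta_twistY_smul, mul_smul_comm, map_smul, smul_sub, Finset.smul_sum,
        smul_mul_assoc]
    rw [h, map_mul, ha, mul_zero]

end FMZV

theorem theorem1p3 (m : ℕ) (w : FMZV.H) (hw : w ∈ FMZV.yH) :
    let F : FMZV.S :=
      FMZV.C w - FMZV.C w * (FMZV.C FMZV.y * FMZV.u) * FMZV.inv (1 + FMZV.C FMZV.x * FMZV.u) *
        ((FMZV.C FMZV.x * FMZV.v) * FMZV.inv (1 - FMZV.C FMZV.x * FMZV.v))
    -- the terms of the series are well defined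
    FMZV.Delta (FMZV.Rx F) ∈ Set.range FMZV.Rx ∧
    (∀ n, FMZV.β m n (FMZV.RxInv (FMZV.Delta (FMZV.Rx F))) ∈ FMZV.H1) ∧
    -- the series converges in `Â`, with the stated sum
    HasSum (fun n : ℕ => FMZV.Z (FMZV.β m n (FMZV.RxInv (FMZV.Delta (FMZV.Rx F)))) * FMZV.bp ^ n)
      (FMZV.Z w * FMZV.Z (FMZV.β m 0 (FMZV.inv (1 - FMZV.C FMZV.y * FMZV.u)))) := by
  obtain ⟨h, rfl⟩ := hw
  intro F
  have hF : F = FMZV.C (FMZV.y * h) * FMZV.corr := by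
    simp only [F, FMZV.corr, LinearMap.mulLeft_apply, mul_sub, mul_one, mul_assoc]
  have hD : FMZV.Delta (FMZV.Rx F) = FMZV.Rx (FMZV.twistY h) := by
    rw [FMZV.Delta_Rx, hF, FMZV.twistY]
  rw [hD, FMZV.RxInv_Rx]
  exact ⟨⟨_, rfl⟩, fun n => Submodule.mem_sup_right (FMZV.beta_twistY_mem h m n),
    FMZV.hasSum_Ahat fun N => FMZV.toA_sum_twistY m N h⟩
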